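/- All posets are finite. The width of a poset is the maximum size of an antichain in it. A poset $P$ is $Q$-free if no induced subposet of $P$ is isomorphic to $Q$. Given a presentation order $x_1,\dots,x_N$ of the elements of a poset $P$ (each element listed exactly once), First-Fit builds an ordered list of chains by putting each $x_k$ in turn into the first existing chain $C$ for which $C\cup\{x_k\}$ is a chain, and into a new chain $\{x_k\}$ at the end of the list if there is no such $C$. For an integer $w\ge 1$ and a poset $Q$, let $\mathrm{FF}(w,Q)\in\mathbb{N}\cup\{\infty\}$ be the supremum, over all $Q$-free posets $P$ of width $w$ and all presentation orders of $P$, of the number of chains that First-Fit uses (with $\mathrm{FF}(w,Q)=0$ if there is no such $P$). The series composition of two posets $Q_1$ and $Q_2$ consists of disjoint copies of $Q_1$ and $Q_2$ with $x<y$ for all $x\in Q_1$, $y\in Q_2$. A poset is ladder-like if its elements can be partitioned into two (possibly empty) chains $C_1$ and $C_2$ such that $x<y$ whenever $x\in C_1$ and $y\in C_2$ are comparable. Let $\mathcal{Q}$ be the smallest isomorphism-closed family of posets that contains all ladder-like posets and is closed under series composition. **Theorem (Dichotomy Theorem).** There is an absolute constant $c>0$ such that the following holds for every $n$ and every $n$-element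 poset $Q$ of width $2$. 1. If $Q\in\mathcal{Q}$, then for every integer $w\ge 1$, $\mathrm{FF}(w,Q)$ is finite and $\mathrm{FF}(w,Q)\le 2^{C(\log_2 w)^2}$ with $C=c\,n$. 2. If $Q\notin\mathcal{Q}$, then $\mathrm{FF}(w,Q)\ge 2^w-1$ for every integer $w\ge 1$. -/

import Mathlib

universe u v

/-- The width of a poset: the largest size of an antichain
(for a finite poset the supremum is a maximum). -/
noncomputable def posetWidth (P : Type u) [PartialOrder P] : ℕ∞ :=
  ⨆ (A : Set P) (_ : IsAntichain (· ≤ ·) A), A.encard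

/-- `P` is `Q`-free: `Q` is not (isomorphic to) a subposet of `P`, i.e. there is no injection
`f : Q → P` with `f a ≤ f b ↔ a ≤ b`. -/
def IsFree (Q : Type v) [PartialOrder Q] (P : Type u) [PartialOrder P] : Prop :=
  ¬ Nonempty (Q ↪o P)

open Classical in
/-- One step of First-Fit: put `x` into the first chain `C` of the list for which `C ∪ {x}` is
still a chain; if there is none, append the new chain `{x}` at the end. -/
noncomputable def firstFitInsert {P : Type u} [PartialOrder P] (x : P) : List (Set P) → List (Set P)
  | [] => [{x}]
  | C :: Cs =>
      if IsChain (· ≤ ·) (insert x C) then insert x C :: Cs else C :: firstFitInsert x Cs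

/-- The ordered chain partition produced by First-Fit when the elements are presented in the
order in which they appear in the list. -/
noncomputable def firstFit {P : Type u} [PartialOrder P] (l : List P) : List (Set P) :=
  l.foldl (fun Cs x => firstFitInsert x Cs) []

/-- A presentation order of `P` lists every element of `P` exactly once. -/
def IsPresentationOrder {P : Type u} (l : List P) : Prop :=
  l.Nodup ∧ ∀ x : P, x ∈ l

/-- `FF w Q`: the maximum number of chains that First-Fit uses, over all finite `Q`-free posets `P`
of width `w` and all presentation orders of `P`. It is a supremum in `ℕ∞`, so it equals `⊤` if the
numbers of chains are unbounded, and `0` if there is no such poset. Up to isomorphism every finite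
poset lives in `Type`. -/
noncomputable def FF (w : ℕ) (Q : Type v) [PartialOrder Q] : ℕ∞ :=
  sSup {k : ℕ∞ | ∃ (P : Type) (_ : PartialOrder P) (_ : Finite P) (l : List P),
    posetWidth P = (w : ℕ∞) ∧ IsFree Q P ∧ IsPresentationOrder l ∧
      k = ((firstFit l).length : ℕ∞)}

/-- A poset is ladder-like if its elements can be partitioned into two (possibly empty) chains
`C₁`, `C₂` such that `x < y` whenever `x ∈ C₁` and `y ∈ C₂` are comparable. -/
def IsLadderLike (Q : Type u) [PartialOrder Q] : Prop :=
  ∃ C₁ C₂ : Set Q, IsChain (· ≤ ·) C₁ ∧ IsChain (· ≤ ·) C₂ ∧ Disjoint C₁ C₂ ∧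
    C₁ ∪ C₂ = Set.univ ∧ ∀ x ∈ C₁, ∀ y ∈ C₂, (x ≤ y ∨ y ≤ x) → x < y

/-- The family `𝒬`: the smallest family of finite posets that contains the finite ladder-like posets
and is closed under series composition. `Q₁ ⊕ₗ Q₂` is the series composition of `Q₁` and `Q₂`
(every element of `Q₁` is below every element of `Q₂`); posets are considered up to isomorphism. -/
inductive LadderSeriesFamily : (Q : Type u) → [PartialOrder Q] → Prop
  | ladderLike (Q : Type u) [PartialOrder Q] [Finite Q] (h : IsLadderLike Q) :
      LadderSeriesFamily Q
  | series (Q₁ Q₂ Q : Type u) [PartialOrder Q₁] [PartialOrder Q₂] [PartialOrder Q]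
      (h₁ : LadderSeriesFamily Q₁) (h₂ : LadderSeriesFamily Q₂) (e : Q ≃o Q₁ ⊕ₗ Q₂) :
      LadderSeriesFamily Q

/-!
The colour classes produced by First-Fit form a Grundy colouring (`IsGrundy`): classes are chains,
and each element is incomparable to some element of each smaller colour. Conversely every Grundy
colouring arises, by presenting the elements colour by colour. So both parts of the theorem are
about the number of colours of Grundy colourings.

*Upper bound.* A Grundy colouring of a poset of width at most `w` without a ladder of size `m` has
`w * (10 * w ^ 2 * (w * m + 1) ^ 2) ^ (log w + 1)` colours at most. The core is
`AntichainInHull.step`: if every chain of `l` distinctly coloured elements has an antichain of `N`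
elements in its hull, then chains longer by a polynomial factor have one of `2 * N` elements. Given
a long chain, a large part of it is buffered (`exists_buffered`), which is the only use of the
absence of ladders: witnesses for elements between two elements of this part stay in the hull of the
whole chain. Then an antichain is grown greedily (`AntichainInHull.round`). Either one of the
rounds produces two long chains with no comparabilities between them, whose hulls are also
incomparable, so that the antichains in the two hulls combine; or all rounds succeed and give an
antichain of `w + 1` elements, which is impossible. After `log w + 1` doublings the antichain would
be larger than `w`.

For a series composition `Q₁ ⊕ Q₂`, a poset without `1 ⊕ Q₁ ⊕ Q₂ ⊕ 1` is cut into the elements not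
above a copy of `1 ⊕ Q₁` and the remaining ones, which have no copy of `Q₂ ⊕ 1` above them. A
partial order on the set of colours decides for each pair of colours on which side the Grundy
property survives, and Mirsky's theorem shows that the numbers of colours multiply
(`ColourBound.series`). Since bracketing a ladder-like poset between a least and a greatest
element keeps it ladder-like, the induction over the family closes.

*Lower bound.* From a poset `P` of width `w` with a Grundy colouring by `a` colours, `Tower` builds
one of width `w + 1` with `2 * a + 1` colours: a chain of rungs next to a stack of blocks, which are
copies of parts of `P`. Comparabilities between blocks and rungs all go in the same direction, so
the subposets of width at most two remain series compositions of ladder-like posets.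
-/

/-! ### Chains and antichains in finite posets -/

/-- Mirsky's theorem in pigeonhole form, for a strict order given as a relation. -/
theorem exists_antichain_or_chain {α : Type*} {r : α → α → Prop} (hir : ∀ a, ¬ r a a)
    (htr : ∀ a b c, r a b → r b c → r a c) (a b : ℕ) (s : Finset α) (hs : a * b < s.card) :
    (∃ A ⊆ s, a < A.card ∧ ∀ x ∈ A, ∀ y ∈ A, ¬ r x y) ∨
      ∃ C ⊆ s, b < C.card ∧ ∀ x ∈ C, ∀ y ∈ C, x ≠ y → r x y ∨ r y x := by
  classical
  -- the induction carries along a least element `m` of the chain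
  suffices h : (∃ A ⊆ s, a < A.card ∧ ∀ x ∈ A, ∀ y ∈ A, ¬ r x y) ∨
      ∃ C ⊆ s, b < C.card ∧ (∃ m ∈ C, ∀ x ∈ C, x ≠ m → r m x) ∧
        ∀ x ∈ C, ∀ y ∈ C, x ≠ y → r x y ∨ r y x by
    rcases h with h | ⟨C, h1, h2, -, h3⟩
    · exact Or.inl h
    · exact Or.inr ⟨C, h1, h2, h3⟩
  induction b generalizing s with
  | zero =>
    obtain ⟨x, hx⟩ := Finset.card_pos.1 (by simpa using hs)
    refine Or.inr ⟨{x}, by simpa using hx, by simp, ⟨x, by simp, by simp⟩, ?_⟩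
    intro y hy z hz hyz
    simp only [Finset.mem_singleton] at hy hz
    exact absurd (hy.trans hz.symm) hyz
  | succ b ih =>
    set M := s.filter (fun x => ∀ y ∈ s, ¬ r y x) with hM
    by_cases hMa : a < M.card
    · refine Or.inl ⟨M, Finset.filter_subset _ _, hMa, fun x hx y hy => ?_⟩
      exact (Finset.mem_filter.1 hy).2 x (Finset.mem_filter.1 hx).1
    have hMs : M ⊆ s := Finset.filter_subset _ _
    have hcard : (s \ M).card = s.card - M.card := Finset.card_sdiff_of_subset hMs
    rcases ih (s \ M) (by rw [hcard]; rw [mul_add] at hs; omega) with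
      ⟨A, hA, hA'⟩ | ⟨C, hC, hCb, ⟨m, hmC, hm⟩, hch⟩
    · exact Or.inl ⟨A, hA.trans Finset.sdiff_subset, hA'⟩
    · have hmM := Finset.mem_sdiff.1 (hC hmC)
      obtain ⟨y, hys, hym⟩ : ∃ y ∈ s, r y m := by
        by_contra hcon
        push Not at hcon
        exact hmM.2 (Finset.mem_filter.2 ⟨hmM.1, hcon⟩)
      have hyall : ∀ x ∈ C, r y x := fun x hx => by
        by_cases hx' : x = m
        · rw [hx']; exact hym
        · exact htr _ _ _ hym (hm x hx hx')
      have hyC : y ∉ C := fun h => hir y (hyall y h)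
      refine Or.inr ⟨insert y C, ?_, ?_, ⟨y, by simp, ?_⟩, ?_⟩
      · exact Finset.insert_subset hys (hC.trans Finset.sdiff_subset)
      · rw [Finset.card_insert_of_notMem hyC]; omega
      · intro x hx hxy
        exact hyall x (Finset.mem_of_mem_insert_of_ne hx hxy)
      · intro x hx z hz hxz
        rcases Finset.mem_insert.1 hx with rfl | hx
        · exact Or.inl (hyall z (Finset.mem_of_mem_insert_of_ne hz hxz.symm))
        · rcases Finset.mem_insert.1 hz with hzy | hz
          · exact Or.inr (hzy ▸ hyall x hx)
          · exact hch x hx z hz hxz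

/-- Incomparability of two elements. -/
abbrev Incomp {P : Type*} [PartialOrder P] (x y : P) : Prop := IncompRel (· ≤ ·) x y

/-- Every antichain of `P` has at most `w` elements. -/
def WidthLE (P : Type*) [PartialOrder P] (w : ℕ) : Prop :=
  ∀ A : Finset P, IsAntichain (· ≤ ·) (A : Set P) → A.card ≤ w

section
variable {P : Type*} [PartialOrder P]

theorem WidthLE.exists_chain {w : ℕ} (hw : WidthLE P w) {b : ℕ} {s : Finset P}
    (hs : w * b < s.card) : ∃ C ⊆ s, b < C.card ∧ IsChain (· ≤ ·) (C : Set P) := by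
  rcases exists_antichain_or_chain (r := fun x y : P => x < y) (fun a => lt_irrefl a)
    (fun a b c => lt_trans) w b s hs with ⟨A, -, hA, h⟩ | ⟨C, hC, hb, h⟩
  · refine absurd (hw A fun x hx y hy hxy hle => h x hx y hy (lt_of_le_of_ne hle hxy)) ?_
    omega
  · exact ⟨C, hC, hb, fun x hx y hy hxy => (h x hx y hy hxy).imp le_of_lt le_of_lt⟩

theorem exists_strictMono_of_isChain (s : Finset P) (hs : IsChain (· ≤ ·) (s : Set P)) :
    ∃ e : Fin s.card → P, StrictMono e ∧ ∀ i, e i ∈ s := by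
  classical
  let _ : LinearOrder s :=
    { (inferInstance : PartialOrder s) with
      le_total := fun a b => hs.total a.2 b.2
      toDecidableLE := Classical.decRel _ }
  let f := Fintype.orderIsoFinOfCardEq s (Fintype.card_coe s)
  exact ⟨fun i => (f i : P), fun i j h => f.strictMono h, fun i => (f i).2⟩

/-- Two chains `x`, `v` of `m` elements such that `x i < v j` for `i ≤ j`, all other pairs
being incomparable. -/
def HasLadder (P : Type*) [PartialOrder P] (m : ℕ) : Prop :=
  ∃ x v : Fin m → P, StrictMono x ∧ StrictMono v ∧ (∀ i j, i ≤ j → x i < v j) ∧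
    ∀ i j, j < i → Incomp (x i) (v j)

theorem HasLadder.of_dual {m : ℕ} (h : HasLadder Pᵒᵈ m) : HasLadder P m := by
  obtain ⟨x, v, hx, hv, h1, h2⟩ := h
  refine ⟨fun i => OrderDual.ofDual (v i.rev), fun i => OrderDual.ofDual (x i.rev),
    fun i j hij => ?_, fun i j hij => ?_, fun i j hij => ?_, fun i j hij => ?_⟩
  · exact hv (Fin.rev_lt_rev.2 hij)
  · exact hx (Fin.rev_lt_rev.2 hij)
  · exact h1 _ _ (Fin.rev_le_rev.2 hij)
  · have := h2 j.rev i.rev (Fin.rev_lt_rev.2 hij)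
    exact ⟨this.1, this.2⟩

theorem WidthLE.dual {w : ℕ} (hw : WidthLE P w) : WidthLE Pᵒᵈ w := fun A hA =>
  hw A (fun _ hx _ hy hxy hle => hA hy hx hxy.symm hle)

theorem exists_large_fiber {α : Type*} [DecidableEq α] (s : Finset α) (n : ℕ) (f : α → ℕ)
    (hf : ∀ a ∈ s, f a < n) (hn : 0 < n) :
    ∃ y, s.card ≤ n * (s.filter (fun a => f a = y)).card := by
  by_contra hcon
  push Not at hcon
  have h1 : s.card = ∑ y ∈ Finset.range n, (s.filter (fun a => f a = y)).card :=
    Finset.card_eq_sum_card_fiberwise (fun a ha => by simpa using hf a ha)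
  have h2 : ∑ y ∈ Finset.range n, n * (s.filter (fun a => f a = y)).card
      < ∑ y ∈ Finset.range n, s.card :=
    Finset.sum_lt_sum_of_nonempty ⟨0, by simpa using hn⟩ (fun y _ => hcon y)
  rw [← Finset.mul_sum, ← h1] at h2
  simp at h2

/-- If a chain `X` lies below `z` and there is no ladder of size `m`, then a large part `I` of `X`
is not cut from above by any element `v` incomparable to `z`: such a `v` is above all of `I`, or
above none of it. The sets of elements of `X` below such `v` are initial segments of `X`, and
more than `w * m` of them would give a ladder. -/
theorem exists_uncut_above [Finite P] {w m : ℕ} (hw : WidthLE P w) (hl : ¬ HasLadder P m)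
    (X : Finset P) (hX : IsChain (· ≤ ·) (X : Set P)) (z : P) (hz : ∀ x ∈ X, x ≤ z) :
    ∃ I ⊆ X, X.card ≤ (w * m + 1) * I.card ∧
      ∀ v, Incomp v z → ∀ x ∈ I, ∀ x' ∈ I, x ≤ v → x' ≤ v := by
  classical
  have := Fintype.ofFinite P
  let σ : P → Finset P := fun v => X.filter (· ≤ v)
  have hσm : ∀ v v', v ≤ v' → σ v ⊆ σ v' := fun v v' h =>
    Finset.monotone_filter_right _ (fun x _ hx => le_trans hx h)
  -- initial segments of a chain are nested
  have hnest : ∀ v v', σ v ⊆ σ v' ∨ σ v' ⊆ σ v := by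
    intro v v'
    by_contra hcon
    push Not at hcon
    obtain ⟨x, hx, hx'⟩ := Finset.not_subset.1 hcon.1
    obtain ⟨y, hy, hy'⟩ := Finset.not_subset.1 hcon.2
    simp only [σ, Finset.mem_filter] at hx hx' hy hy'
    rcases hX.total hx.1 hy.1 with h | h
    · exact hx' ⟨hx.1, h.trans hy.2⟩
    · exact hy' ⟨hy.1, h.trans hx.2⟩
  set S : Finset (Finset P) := (Finset.univ.filter (fun v => Incomp v z)).image σ with hS
  have hScard : S.card ≤ w * m := by
    by_contra hcon
    push Not at hcon
    have hrep : ∀ s ∈ S, ∃ v, Incomp v z ∧ σ v = s := by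
      intro s hs
      simpa [hS] using hs
    have : Nonempty P := by
      obtain ⟨s, hs⟩ := Finset.card_pos.1 (Nat.zero_lt_of_lt hcon)
      exact ⟨(hrep s hs).choose⟩
    choose! rep hrep1 hrep2 using hrep
    have hinj : Set.InjOn rep S := fun s hs s' hs' h => by
      rw [← hrep2 s hs, ← hrep2 s' hs', h]
    rw [← Finset.card_image_of_injOn hinj] at hcon
    obtain ⟨C, hC, hCm, hCc⟩ := hw.exists_chain hcon
    obtain ⟨e, he, heC⟩ := exists_strictMono_of_isChain C hCc
    let v : Fin (m + 1) → P := fun i => e (i.castLE hCm)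
    have hv : StrictMono v := fun i j h => he (by simpa using h)
    have hvS : ∀ i, ∃ s ∈ S, rep s = v i := fun i => by
      simpa using hC (heC (i.castLE hCm))
    have hvz : ∀ i, Incomp (v i) z := fun i => by
      obtain ⟨s, hs, h⟩ := hvS i
      rw [← h]; exact hrep1 s hs
    have hss : ∀ i j, i < j → ∃ x ∈ X, x ≤ v j ∧ ¬ x ≤ v i := by
      intro i j hij
      by_contra hcon'
      push Not at hcon'
      have h1 : σ (v i) = σ (v j) := by
        refine (hσm _ _ (hv hij).le).antisymm fun x hx => ?_
        simp only [σ, Finset.mem_filter] at hx ⊢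
        exact ⟨hx.1, hcon' x hx.1 hx.2⟩
      obtain ⟨s, hs, h⟩ := hvS i
      obtain ⟨s', hs', h'⟩ := hvS j
      have : s = s' := by rw [← hrep2 s hs, ← hrep2 s' hs', h, h', h1]
      exact (hv hij).ne (by rw [← h, ← h', this])
    choose x hxX hx1 hx2 using fun i : Fin m => hss i.castSucc i.succ (by simp)
    have hxz : ∀ i j, ¬ v j ≤ x i := fun i j h => (hvz j).1 (h.trans (hz _ (hxX i)))
    have hxne : ∀ i j, x i ≠ v j := fun i j h => hxz i j h.ge
    refine hl ⟨x, fun j => v j.succ, fun i j hij => ?_, fun i j hij => hv (by simpa using hij),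
      fun i j hij => ?_, fun i j hij => ?_⟩
    · have h1 : ¬ x j ≤ x i := fun h => hx2 j (h.trans ((hx1 i).trans (hv.monotone (by
        rw [Fin.le_iff_val_le_val]; simpa using hij))))
      rcases hX.total (hxX i) (hxX j) with h | h
      · exact lt_of_le_not_ge h h1
      · exact absurd h h1
    · exact lt_of_le_of_ne ((hx1 i).trans (hv.monotone (by simpa using hij))) (hxne _ _)
    · refine ⟨fun h => hx2 i (h.trans (hv.monotone (by
        rw [Fin.le_iff_val_le_val]; simpa using hij))), hxz _ _⟩
  -- elements of `X` lying in equally many of the nested segments lie in the same segments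
  let φ : P → ℕ := fun x => (S.filter (fun s => x ∈ s)).card
  obtain ⟨k, hk⟩ := exists_large_fiber X (w * m + 1) φ (fun x _ =>
    Nat.lt_succ_of_le ((Finset.card_filter_le _ _).trans hScard)) (Nat.succ_pos _)
  refine ⟨X.filter (fun a => φ a = k), Finset.filter_subset _ _, hk, ?_⟩
  intro v hv x hx x' hx' hxv
  rw [Finset.mem_filter] at hx hx'
  rcases hX.total hx.1 hx'.1 with h | h
  · have hsub : S.filter (fun s => x' ∈ s) ⊆ S.filter (fun s => x ∈ s) := by
      intro s hs
      rw [Finset.mem_filter] at hs ⊢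
      refine ⟨hs.1, ?_⟩
      obtain ⟨u, -, rfl⟩ := Finset.mem_image.1 hs.1
      simp only [σ, Finset.mem_filter] at hs ⊢
      exact ⟨hx.1, h.trans hs.2.2⟩
    have heq := Finset.eq_of_subset_of_card_le hsub (by
      have h1 := hx.2; have h2 := hx'.2
      simp only [φ] at h1 h2
      omega)
    have hmem : σ v ∈ S.filter (fun s => x ∈ s) := by
      refine Finset.mem_filter.2 ⟨Finset.mem_image_of_mem _ (by simpa using hv), ?_⟩
      simpa [σ] using ⟨hx.1, hxv⟩
    rw [← heq] at hmem
    have := (Finset.mem_filter.1 hmem).2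
    simp only [σ, Finset.mem_filter] at this
    exact this.2
  · exact h.trans hxv

theorem exists_uncut_below [Finite P] {w m : ℕ} (hw : WidthLE P w) (hl : ¬ HasLadder P m)
    (X : Finset P) (hX : IsChain (· ≤ ·) (X : Set P)) (z : P) (hz : ∀ x ∈ X, z ≤ x) :
    ∃ I ⊆ X, X.card ≤ (w * m + 1) * I.card ∧
      ∀ v, Incomp v z → ∀ x ∈ I, ∀ x' ∈ I, v ≤ x → v ≤ x' := by
  obtain ⟨I, hI, hc, h⟩ := exists_uncut_above (P := Pᵒᵈ) hw.dual (fun h => hl h.of_dual) X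
    hX.symm z hz
  exact ⟨I, hI, hc, fun v hv => h v ⟨hv.2, hv.1⟩⟩

end

/-! ### Grundy colourings and rich chains -/

section
variable {P : Type*} [PartialOrder P]

/-- The structure that First-Fit leaves behind: every colour class is a chain, and every element
is incomparable to some element of each smaller colour in use. -/
structure IsGrundy (g : P → ℕ) : Prop where
  comparable : ∀ x y, g x = g y → x ≤ y ∨ y ≤ x
  witness : ∀ x y, g y < g x → ∃ z, g z = g y ∧ Incomp z x

/-- `v` lies between two elements of `X`. -/
def InHull (X : Finset P) (v : P) : Prop := ∃ a ∈ X, ∃ b ∈ X, a ≤ v ∧ v ≤ b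

theorem InHull.of_mem {X : Finset P} {v : P} (h : v ∈ X) : InHull X v :=
  ⟨v, h, v, h, le_rfl, le_rfl⟩

theorem InHull.trans {X Y : Finset P} (hY : ∀ y ∈ Y, InHull X y) {v : P} (hv : InHull Y v) :
    InHull X v := by
  obtain ⟨a, ha, b, hb, hav, hvb⟩ := hv
  obtain ⟨a', ha', -, -, h1, -⟩ := hY a ha
  obtain ⟨-, -, b', hb', -, h2⟩ := hY b hb
  exact ⟨a', ha', b', hb', h1.trans hav, hvb.trans h2⟩

theorem InHull.incomp {X Y : Finset P} (h : ∀ x ∈ X, ∀ y ∈ Y, Incomp x y) {u v : P}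
    (hu : InHull X u) (hv : InHull Y v) : Incomp u v := by
  obtain ⟨a, ha, b, hb, hau, hub⟩ := hu
  obtain ⟨c, hc, d, hd, hcv, hvd⟩ := hv
  exact ⟨fun huv => (h a ha d hd).1 (hau.trans (huv.trans hvd)),
    fun hvu => (h b hb c hc).2 (hcv.trans (hvu.trans hub))⟩

/-- A large part `I` of a chain `X` is buffered: a witness of a colour of `I` for an element of
the hull of `I` cannot leave the hull of `X`. -/
theorem exists_buffered [Finite P] {w m : ℕ} (hw : WidthLE P w) (hl : ¬ HasLadder P m)
    {g : P → ℕ} (hg : IsGrundy g) (X : Finset P) (hX : IsChain (· ≤ ·) (X : Set P)) :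
    ∃ I ⊆ X, X.card ≤ (w * m + 1) ^ 2 * I.card ∧
      ∀ u v, InHull I u → (∃ x ∈ I, g v = g x) → Incomp v u → InHull X v := by
  rcases X.eq_empty_or_nonempty with rfl | hne
  · exact ⟨∅, le_rfl, by simp, fun u v ⟨a, ha, _⟩ => by simp at ha⟩
  obtain ⟨zt, hzt, hztop⟩ : ∃ z ∈ X, ∀ x ∈ X, x ≤ z := by
    obtain ⟨z, hz⟩ := X.exists_maximal hne
    exact ⟨z, hz.1, fun x hx => (hX.total hx hz.1).elim id (fun h => hz.2 hx h)⟩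
  obtain ⟨zb, hzb, hzbot⟩ : ∃ z ∈ X, ∀ x ∈ X, z ≤ x := by
    obtain ⟨z, hz⟩ := X.exists_minimal hne
    exact ⟨z, hz.1, fun x hx => (hX.total hz.1 hx).elim id (fun h => hz.2 hx h)⟩
  obtain ⟨J, hJ, hJc, hJu⟩ := exists_uncut_above hw hl X hX zt hztop
  obtain ⟨I, hI, hIc, hIu⟩ := exists_uncut_below hw hl J (hX.mono (by exact_mod_cast hJ)) zb
    (fun x hx => hzbot x (hJ hx))
  refine ⟨I, hI.trans hJ, ?_, ?_⟩
  · calc X.card ≤ (w * m + 1) * J.card := hJc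
      _ ≤ (w * m + 1) * ((w * m + 1) * I.card) := Nat.mul_le_mul_left _ hIc
      _ = _ := by ring
  · rintro u v ⟨a, ha, b, hb, hau, hub⟩ ⟨x, hx, hvx⟩ hvu
    refine ⟨zb, hzb, zt, hzt, ?_, ?_⟩
    · by_contra hcon
      have hinc : Incomp v zb :=
        ⟨fun h => hvu.1 (h.trans ((hzbot a (hJ (hI ha))).trans hau)), hcon⟩
      have hxv : v ≤ x := (hg.comparable _ _ hvx).elim id (fun h =>
        absurd ((hzbot x (hJ (hI hx))).trans h) hcon)
      exact hvu.1 ((hIu v hinc x hx a ha hxv).trans hau)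
    · by_contra hcon
      have hinc : Incomp v zt :=
        ⟨hcon, fun h => hvu.2 (hub.trans ((hztop b (hJ (hI hb))).trans h))⟩
      have hxv : x ≤ v := (hg.comparable _ _ hvx).elim (fun h =>
        absurd (h.trans (hztop x (hJ (hI hx)))) hcon) id
      exact hvu.2 (hub.trans (hJu v hinc x (hI hx) b (hI hb) hxv))

theorem exists_top_subset (J : Finset ℕ) (k : ℕ) (hk : k ≤ J.card) :
    ∃ K ⊆ J, K.card = k ∧ ∀ i ∈ J \ K, ∀ j ∈ K, i < j := by
  induction k with
  | zero => exact ⟨∅, by simp, rfl, by simp⟩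
  | succ k ih =>
    obtain ⟨K, hK, hKc, h⟩ := ih (by omega)
    have hne : (J \ K).Nonempty := by
      rw [← Finset.card_pos, Finset.card_sdiff_of_subset hK]; omega
    have hm := Finset.max'_mem _ hne
    set M := (J \ K).max' hne
    refine ⟨insert M K, ?_, ?_, ?_⟩
    · exact Finset.insert_subset (Finset.mem_sdiff.1 hm).1 hK
    · rw [Finset.card_insert_of_notMem (Finset.mem_sdiff.1 hm).2, hKc]
    · intro i hi j hj
      simp only [Finset.mem_sdiff, Finset.mem_insert, not_or] at hi hj
      have hi' : i ∈ J \ K := Finset.mem_sdiff.2 ⟨hi.1, hi.2.2⟩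
      rcases hj with rfl | hj
      · exact lt_of_le_of_ne (Finset.le_max' _ _ hi') hi.2.1
      · exact h i hi' j hj

theorem exists_representatives {P : Type*} (g : P → ℕ) (J : Finset ℕ) (p : P → Prop)
    (h : ∀ i ∈ J, ∃ u, g u = i ∧ p u) :
    ∃ V : Finset P, V.card = J.card ∧ Set.InjOn g V ∧ ∀ u ∈ V, g u ∈ J ∧ p u := by
  classical
  choose f hf hp using h
  refine ⟨J.attach.image (fun i => f i.1 i.2), ?_, ?_, ?_⟩
  · rw [Finset.card_image_of_injective, Finset.card_attach]
    intro i j hij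
    have := congrArg g hij
    simp only [hf] at this
    exact Subtype.ext this
  · intro u hu v hv huv
    simp only [Finset.coe_image, Set.mem_image] at hu hv
    obtain ⟨i, -, rfl⟩ := hu
    obtain ⟨j, -, rfl⟩ := hv
    rw [hf, hf] at huv
    have : i = j := Subtype.ext huv
    rw [this]
  · intro u hu
    obtain ⟨i, -, rfl⟩ := Finset.mem_image.1 hu
    exact ⟨by rw [hf]; exact i.2, hp _ _⟩

/-- `g` has the antichain property for `(l, N)` if the hull of each chain of at least `l` elements
of distinct colours contains an antichain of `N` elements. -/
def AntichainInHull (g : P → ℕ) (l N : ℕ) : Prop :=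
  ∀ X : Finset P, IsChain (· ≤ ·) (X : Set P) → Set.InjOn g X → l ≤ X.card →
    ∃ A : Finset P, IsAntichain (· ≤ ·) (A : Set P) ∧ N ≤ A.card ∧ ∀ a ∈ A, InHull X a

/-- Two rich families inside the hull of `X`, with no comparabilities between them, double the
antichain. -/
theorem AntichainInHull.double {w l N : ℕ} (hw : WidthLE P w) {g : P → ℕ}
    (h : AntichainInHull g l N) {X Y V : Finset P}
    (hYc : IsChain (· ≤ ·) (Y : Set P))
    (hYg : Set.InjOn g Y) (hYl : l ≤ Y.card) (hVg : Set.InjOn g V) (hVl : w * l < V.card)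
    (hYX : ∀ y ∈ Y, InHull X y) (hVX : ∀ v ∈ V, InHull X v)
    (hYV : ∀ y ∈ Y, ∀ v ∈ V, Incomp y v) :
    ∃ A : Finset P, IsAntichain (· ≤ ·) (A : Set P) ∧ 2 * N ≤ A.card ∧ ∀ a ∈ A, InHull X a := by
  classical
  obtain ⟨Z, hZV, hZl, hZc⟩ := hw.exists_chain hVl
  obtain ⟨A, hA, hAN, hAY⟩ := h Y hYc hYg hYl
  obtain ⟨B, hB, hBN, hBZ⟩ := h Z hZc (hVg.mono (by exact_mod_cast hZV)) hZl.le
  have hinc : ∀ a ∈ A, ∀ b ∈ B, Incomp a b := fun a ha b hb =>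
    InHull.incomp (fun y hy z hz => hYV y hy z (hZV hz)) (hAY a ha) (hBZ b hb)
  refine ⟨A ∪ B, ?_, ?_, ?_⟩
  · intro x hx y hy hxy
    simp only [Finset.coe_union, Set.mem_union, Finset.mem_coe] at hx hy
    rcases hx with hx | hx <;> rcases hy with hy | hy
    · exact hA hx hy hxy
    · exact (hinc x hx y hy).1
    · exact (hinc y hy x hx).2
    · exact hB hx hy hxy
  · rw [Finset.card_union_of_disjoint]
    · omega
    · rw [Finset.disjoint_left]
      intro a ha hb
      exact (hinc a ha a hb).1 le_rfl
  · intro a ha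
    rcases Finset.mem_union.1 ha with ha | ha
    · exact InHull.trans hYX (hAY a ha)
    · exact InHull.trans (fun z hz => hVX z (hZV hz)) (hBZ a ha)

/-- One round of the antichain search. The set `A` is an antichain, and the colours of `J` can be
supplied by elements of the hull of `I` incomparable to all of `A`. The largest colours of `J`
yield a chain `C` of such elements, of size at least `2 * l + 1`; let `p` be its middle. If many
smaller colours have an element incomparable to `p` but not caught between the ends of `C`, then
these elements are incomparable to one half of `C`, and `AntichainInHull.double` applies.
Otherwise, for all other colours of `J`, the witnesses for `p` lie between the ends of `C`, hence
are incomparable to `A`, so `p` can be added to `A`. -/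
theorem AntichainInHull.round {w l N : ℕ} (hw : WidthLE P w) {g : P → ℕ} (hg : IsGrundy g)
    (h : AntichainInHull g l N) {X I : Finset P}
    (hIX : I ⊆ X)
    (hbuf : ∀ u v, InHull I u → (∃ x ∈ I, g v = g x) → Incomp v u → InHull X v)
    {A : Finset P} (hA : IsAntichain (· ≤ ·) (A : Set P)) {J : Finset ℕ}
    (hJI : ∀ i ∈ J, ∃ x ∈ I, g x = i)
    (hsup : ∀ i ∈ J, ∃ u, g u = i ∧ InHull I u ∧ ∀ a ∈ A, Incomp u a)
    (hJ : w * (2 * l) + 1 ≤ J.card) :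
    (∃ B : Finset P, IsAntichain (· ≤ ·) (B : Set P) ∧ 2 * N ≤ B.card ∧ ∀ b ∈ B, InHull X b) ∨
    ∃ A' : Finset P, IsAntichain (· ≤ ·) (A' : Set P) ∧ A'.card = A.card + 1 ∧ ∃ J' ⊆ J,
      J.card ≤ J'.card + (w * (2 * l) + 1 + 2 * (w * l)) ∧
      ∀ i ∈ J', ∃ u, g u = i ∧ InHull I u ∧ ∀ a ∈ A', Incomp u a := by
  classical
  have hhull : ∀ u, InHull I u → InHull X u := fun u hu =>
    InHull.trans (fun y hy => InHull.of_mem (hIX hy)) hu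
  obtain ⟨K, hKJ, hKc, hK⟩ := exists_top_subset J _ hJ
  obtain ⟨V, hVc, hVg, hV⟩ := exists_representatives g K _ (fun i hi => hsup i (hKJ hi))
  obtain ⟨C, hCV, hCl, hCc⟩ := hw.exists_chain (b := 2 * l) (s := V) (by omega)
  obtain ⟨e, he, heC⟩ := exists_strictMono_of_isChain C hCc
  have hCI : ∀ c ∈ C, InHull I c := fun c hc => (hV c (hCV hc)).2.1
  have hCA : ∀ c ∈ C, ∀ a ∈ A, Incomp c a := fun c hc => (hV c (hCV hc)).2.2
  have hCg : Set.InjOn g C := hVg.mono (by exact_mod_cast hCV)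
  let lo : Fin C.card := ⟨0, by omega⟩
  let mid : Fin C.card := ⟨l, by omega⟩
  let hi : Fin C.card := ⟨2 * l, hCl⟩
  have hpC := heC mid
  -- the two halves of `C`, both containing the middle element
  let Clo : Finset P := (Finset.Icc lo mid).image e
  let Chi : Finset P := (Finset.Icc mid hi).image e
  have hClo : Clo ⊆ C := fun c hc => by
    obtain ⟨i, -, rfl⟩ := Finset.mem_image.1 hc; exact heC i
  have hChi : Chi ⊆ C := fun c hc => by
    obtain ⟨i, -, rfl⟩ := Finset.mem_image.1 hc; exact heC i
  have hCloc : l ≤ Clo.card := by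
    rw [Finset.card_image_of_injective _ he.injective, Fin.card_Icc]
    simp only [lo, mid]; omega
  have hChic : l ≤ Chi.card := by
    rw [Finset.card_image_of_injective _ he.injective, Fin.card_Icc]
    simp only [hi, mid]; omega
  -- colours with an element incomparable to the middle that escapes below or above
  set L := J \ K with hL
  have hLI : ∀ v, g v ∈ L → ∃ x ∈ I, g v = g x := fun v hv => by
    obtain ⟨x, hx, hxv⟩ := hJI _ (Finset.mem_sdiff.1 hv).1
    exact ⟨x, hx, hxv.symm⟩
  set Bl := L.filter (fun i => ∃ v, g v = i ∧ (Incomp v (e mid) ∧ ¬ e lo ≤ v)) with hBl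
  set Bh := L.filter (fun i => ∃ v, g v = i ∧ (Incomp v (e mid) ∧ ¬ v ≤ e hi)) with hBh
  by_cases hBlc : w * l < Bl.card
  · left
    obtain ⟨U, hUc, hUg, hU⟩ := exists_representatives g Bl _
      (fun i hi => (Finset.mem_filter.1 hi).2)
    refine h.double hw (X := X) (Y := Clo) (V := U) (hCc.mono (by exact_mod_cast hClo))
      (hCg.mono (by exact_mod_cast hClo)) hCloc hUg (by omega)
      (fun y hy => hhull _ (hCI y (hClo hy))) (fun v hv => ?_) (fun y hy v hv => ?_)
    · exact hbuf _ _ (hCI _ hpC) (hLI v (Finset.mem_filter.1 (hU v hv).1).1) (hU v hv).2.1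
    · obtain ⟨i, hi', rfl⟩ := Finset.mem_image.1 hy
      rw [Finset.mem_Icc] at hi'
      exact ⟨fun hle => (hU v hv).2.2 ((he.monotone hi'.1).trans hle),
        fun hle => (hU v hv).2.1.1 (hle.trans (he.monotone hi'.2))⟩
  by_cases hBhc : w * l < Bh.card
  · left
    obtain ⟨U, hUc, hUg, hU⟩ := exists_representatives g Bh _
      (fun i hi => (Finset.mem_filter.1 hi).2)
    refine h.double hw (X := X) (Y := Chi) (V := U) (hCc.mono (by exact_mod_cast hChi))
      (hCg.mono (by exact_mod_cast hChi)) hChic hUg (by omega)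
      (fun y hy => hhull _ (hCI y (hChi hy))) (fun v hv => ?_) (fun y hy v hv => ?_)
    · exact hbuf _ _ (hCI _ hpC) (hLI v (Finset.mem_filter.1 (hU v hv).1).1) (hU v hv).2.1
    · obtain ⟨i, hi', rfl⟩ := Finset.mem_image.1 hy
      rw [Finset.mem_Icc] at hi'
      exact ⟨fun hle => (hU v hv).2.1.2 ((he.monotone hi'.1).trans hle),
        fun hle => (hU v hv).2.2 (hle.trans (he.monotone hi'.2))⟩
  right
  have hpA : e mid ∉ A := fun hp => (hCA _ hpC _ hp).1 le_rfl
  refine ⟨insert (e mid) A, ?_, Finset.card_insert_of_notMem hpA, L \ (Bl ∪ Bh), ?_, ?_, ?_⟩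
  · rw [Finset.coe_insert]
    refine hA.insert (fun b hb _ => (hCA _ hpC b hb).2) (fun b hb _ => (hCA _ hpC b hb).1)
  · exact Finset.sdiff_subset.trans Finset.sdiff_subset
  · have h1 : L.card = J.card - K.card := Finset.card_sdiff_of_subset hKJ
    have h2 := Finset.le_card_sdiff (Bl ∪ Bh) L
    have h3 := Finset.card_union_le Bl Bh
    omega
  · intro i hi'
    rw [Finset.mem_sdiff, Finset.mem_union, not_or] at hi'
    obtain ⟨hiL, hiBl, hiBh⟩ := hi'
    obtain ⟨x, hx, rfl⟩ := hJI i (Finset.mem_sdiff.1 hiL).1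
    obtain ⟨v, hvx, hvp⟩ := hg.witness (e mid) x (hK _ hiL _ (hV _ (hCV hpC)).1)
    have hlo : e lo ≤ v := by
      by_contra hcon
      exact hiBl (Finset.mem_filter.2 ⟨hiL, v, hvx, hvp, hcon⟩)
    have hhi : v ≤ e hi := by
      by_contra hcon
      exact hiBh (Finset.mem_filter.2 ⟨hiL, v, hvx, hvp, hcon⟩)
    refine ⟨v, hvx, InHull.trans hCI ⟨_, heC lo, _, heC hi, hlo, hhi⟩, fun a ha => ?_⟩
    rcases Finset.mem_insert.1 ha with rfl | ha
    · exact hvp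
    · exact ⟨fun hle => (hCA _ (heC lo) a ha).1 (hlo.trans hle),
        fun hle => (hCA _ (heC hi) a ha).2 (hle.trans hhi)⟩

/-- In a Grundy colouring without large ladders, a polynomial factor in the length of a chain of
distinctly coloured elements doubles the antichain that can be found in its hull. -/
theorem AntichainInHull.step [Finite P] {w m l N : ℕ} (hw : WidthLE P w) (hw0 : 0 < w)
    (hl : ¬ HasLadder P m) {g : P → ℕ} (hg : IsGrundy g) (h : AntichainInHull g l N)
    (hl0 : 0 < l) :
    AntichainInHull g (10 * w ^ 2 * (w * m + 1) ^ 2 * l) (2 * N) := by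
  classical
  intro X hX hXg hXc
  obtain ⟨I, hIX, hIc, hbuf⟩ := exists_buffered hw hl hg X hX
  by_contra hcon
  have hI : 10 * w ^ 2 * l ≤ I.card := by
    have h1 : (w * m + 1) ^ 2 * (10 * w ^ 2 * l) ≤ (w * m + 1) ^ 2 * I.card := by
      calc _ = 10 * w ^ 2 * (w * m + 1) ^ 2 * l := by ring
        _ ≤ _ := hXc.trans hIc
    exact Nat.le_of_mul_le_mul_left h1 (by positivity)
  have hIg : Set.InjOn g I := hXg.mono (by exact_mod_cast hIX)
  have hwl : 1 ≤ w * l := Nat.mul_pos hw0 hl0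
  -- `w + 1` rounds are affordable, and they give an antichain of `w + 1` elements
  have key : ∀ s ≤ w + 1, ∃ A : Finset P, IsAntichain (· ≤ ·) (A : Set P) ∧ A.card = s ∧
      ∃ J ⊆ I.image g, I.card ≤ J.card + s * (5 * (w * l)) ∧
      ∀ i ∈ J, ∃ u, g u = i ∧ InHull I u ∧ ∀ a ∈ A, Incomp u a := by
    intro s
    induction s with
    | zero =>
      refine fun _ => ⟨∅, by simp, rfl, I.image g, le_rfl, ?_, fun i hi => ?_⟩
      · rw [Finset.card_image_of_injOn hIg]; simp
      · obtain ⟨x, hx, rfl⟩ := Finset.mem_image.1 hi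
        exact ⟨x, rfl, InHull.of_mem hx, by simp⟩
    | succ s ih =>
      intro hs
      obtain ⟨A, hA, hAs, J, hJ, hJc, hsup⟩ := ih (by omega)
      have h1 : (s + 1) * (5 * (w * l)) ≤ 10 * w ^ 2 * l := by
        calc (s + 1) * (5 * (w * l)) ≤ (2 * w) * (5 * (w * l)) :=
              Nat.mul_le_mul_right _ (by omega)
          _ = 10 * w ^ 2 * l := by ring
      have h2 : w * (2 * l) = 2 * (w * l) := by ring
      rw [add_mul, one_mul] at h1
      rcases h.round hw hg hIX hbuf hA (fun i hi => by simpa using hJ hi) hsup (by omega) with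
        hB | ⟨A', hA', hA's, J', hJ', hJ'c, hsup'⟩
      · exact absurd hB hcon
      · refine ⟨A', hA', by omega, J', hJ'.trans hJ, ?_, hsup'⟩
        rw [add_mul, one_mul]
        omega
  obtain ⟨A, hA, hAs, -⟩ := key (w + 1) le_rfl
  have := hw A hA
  omega

theorem antichainInHull_pow [Finite P] {w m : ℕ} (hw : WidthLE P w) (hw0 : 0 < w)
    (hl : ¬ HasLadder P m) {g : P → ℕ} (hg : IsGrundy g) (t : ℕ) :
    AntichainInHull g ((10 * w ^ 2 * (w * m + 1) ^ 2) ^ t) (2 ^ t) := by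
  induction t with
  | zero =>
    intro X _ _ hXc
    obtain ⟨x, hx⟩ := Finset.card_pos.1 (Nat.lt_of_lt_of_le (by simp) hXc)
    exact ⟨{x}, by simp, by simp, by simpa using InHull.of_mem hx⟩
  | succ t ih =>
    have := ih.step hw hw0 hl hg (by positivity)
    rwa [pow_succ' _ t, pow_succ' 2 t]

/-- A Grundy colouring of a poset of width at most `w` without a ladder of size `m` uses few
colours. -/
theorem IsGrundy.ncard_range_le_of_not_hasLadder [Finite P] {w m : ℕ} (hw : WidthLE P w)
    (hw0 : 0 < w) (hl : ¬ HasLadder P m) {g : P → ℕ} (hg : IsGrundy g) :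
    (Set.range g).ncard ≤ w * (10 * w ^ 2 * (w * m + 1) ^ 2) ^ (Nat.log 2 w + 1) := by
  classical
  by_contra hcon
  push Not at hcon
  have hfin : (Set.range g).Finite := Set.finite_range g
  obtain ⟨V, hVc, hVg, -⟩ := exists_representatives g hfin.toFinset (fun _ => True)
    (fun i hi => by simpa using hi)
  rw [Set.ncard_eq_toFinset_card _ hfin, ← hVc] at hcon
  obtain ⟨C, hCV, hCl, hCc⟩ := hw.exists_chain hcon
  obtain ⟨A, hA, hAc, -⟩ := antichainInHull_pow hw hw0 hl hg (Nat.log 2 w + 1) C hCc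
    (hVg.mono (by exact_mod_cast hCV)) hCl.le
  have h1 := hw A hA
  have h2 := Nat.lt_pow_succ_log_self (b := 2) (by norm_num) w
  simp only [Nat.succ_eq_add_one] at h2
  omega

end

/-! ### Ladder-like posets and series compositions -/

/-- `P` contains a copy of `Q` together with a common strict lower bound and a common strict upper
bound of this copy; that is, a copy of `1 ⊕ Q ⊕ 1`. -/
def HasBracketed (Q : Type*) [PartialOrder Q] (P : Type*) [PartialOrder P] : Prop :=
  ∃ (f : Q ↪o P) (lo hi : P), lo < hi ∧ ∀ q, lo < f q ∧ f q < hi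

theorem IsLadderLike.hasBracketed {Q : Type*} [PartialOrder Q] [Finite Q] (hQ : IsLadderLike Q)
    {P : Type*} [PartialOrder P] (hP : HasLadder P (Nat.card Q + 2)) : HasBracketed Q P := by
  classical
  have := Fintype.ofFinite Q
  obtain ⟨C₁, C₂, h₁, h₂, hd, hu, hlad⟩ := hQ
  obtain ⟨x, v, hx, hv, hxv, hinc⟩ := hP
  have hmem : ∀ q, q ∉ C₁ → q ∈ C₂ := fun q hq =>
    ((Set.ext_iff.1 hu q).2 trivial).resolve_left hq
  have hdis : ∀ q, q ∈ C₁ → q ∉ C₂ := fun q h h' => Set.disjoint_left.1 hd h h'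
  -- positions on the ladder: all positions up to and including that of `q` are taken from
  -- a linear extension in which an element of `C₂` precedes its incomparable elements of `C₁`
  let S : Q → Finset Q := fun q =>
    if q ∈ C₁ then Finset.univ.filter (fun z => (z ∈ C₁ ∧ z ≤ q) ∨ (z ∈ C₂ ∧ ¬ q < z))
    else Finset.univ.filter (fun z => (z ∈ C₁ ∧ z < q) ∨ (z ∈ C₂ ∧ z ≤ q))
  have hS1 : ∀ q ∈ C₁, ∀ z, z ∈ S q ↔ (z ∈ C₁ ∧ z ≤ q) ∨ (z ∈ C₂ ∧ ¬ q < z) := fun q hq z => by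
    simp [S, hq]
  have hS2 : ∀ q ∈ C₂, ∀ z, z ∈ S q ↔ (z ∈ C₁ ∧ z < q) ∨ (z ∈ C₂ ∧ z ≤ q) := fun q hq z => by
    have : q ∉ C₁ := fun h => hdis q h hq
    simp [S, this]
  have hself : ∀ q, q ∈ S q := fun q => by
    by_cases hq : q ∈ C₁
    · exact (hS1 q hq q).2 (Or.inl ⟨hq, le_rfl⟩)
    · exact (hS2 q (hmem q hq) q).2 (Or.inr ⟨hmem q hq, le_rfl⟩)
  have hcross : ∀ a ∈ C₁, ∀ b ∈ C₂, ¬ b ≤ a := fun a ha b hb h =>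
    absurd h (not_le_of_gt (hlad a ha b hb (Or.inr h)))
  have hS : ∀ a b, (a < b ∨ (a ∈ C₂ ∧ b ∈ C₁ ∧ ¬ b < a)) → S a ⊂ S b := by
    intro a b hab
    have hne : a ≠ b := by
      rintro rfl
      rcases hab with h | h
      · exact lt_irrefl _ h
      · exact hdis _ h.2.1 h.1
    refine Finset.ssubset_iff_subset_ne.2 ⟨fun z hz => ?_, fun heq => ?_⟩
    · by_cases ha : a ∈ C₁ <;> by_cases hb : b ∈ C₁
      · have hab' : a < b := hab.resolve_right fun h => hdis _ ha h.1
        rw [hS1 a ha] at hz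
        rw [hS1 b hb]
        exact hz.imp (fun h => ⟨h.1, h.2.trans hab'.le⟩)
          (fun h => ⟨h.1, fun h' => h.2 (hab'.trans h')⟩)
      · have hab' : a < b := hab.resolve_right fun h => hdis _ ha h.1
        have hb := hmem b hb
        rw [hS1 a ha] at hz
        rw [hS2 b hb]
        refine hz.imp (fun h => ⟨h.1, lt_of_le_of_lt h.2 hab'⟩) (fun h => ⟨h.1, ?_⟩)
        exact (h₂.total h.1 hb).elim id (fun h' => absurd (lt_of_lt_of_le hab' h') h.2)
      · have ha := hmem a ha
        have hab' : ¬ b < a := by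
          rcases hab with h | h
          · exact fun h' => lt_asymm h h'
          · exact h.2.2
        rw [hS2 a ha] at hz
        rw [hS1 b hb]
        refine hz.imp (fun h => ⟨h.1, ?_⟩) (fun h => ⟨h.1, fun h' => hab' (lt_of_lt_of_le h' h.2)⟩)
        exact (h₁.total h.1 hb).elim id (fun h' => absurd (lt_of_le_of_lt h' h.2) hab')
      · have ha := hmem a ha
        have hab' : a < b := hab.resolve_right fun h => hb h.2.1
        have hb := hmem b hb
        rw [hS2 a ha] at hz
        rw [hS2 b hb]
        exact hz.imp (fun h => ⟨h.1, h.2.trans hab'⟩) (fun h => ⟨h.1, h.2.trans hab'.le⟩)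
    · have hba : b ∈ S a := heq ▸ hself b
      by_cases ha : a ∈ C₁
      · have hab' : a < b := hab.resolve_right fun h => hdis _ ha h.1
        rw [hS1 a ha] at hba
        rcases hba with h | h
        · exact absurd h.2 (not_le_of_gt hab')
        · exact h.2 hab'
      · have ha := hmem a ha
        rw [hS2 a ha] at hba
        rcases hab with hab | hab
        · rcases hba with h | h
          · exact lt_asymm h.2 hab
          · exact absurd h.2 (not_le_of_gt hab)
        · rcases hba with h | h
          · exact hab.2.2 h.2
          · exact hdis _ hab.2.1 h.1
  have hcard : ∀ q, 0 < (S q).card ∧ (S q).card < Nat.card Q + 1 := fun q => by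
    refine ⟨Finset.card_pos.2 ⟨q, hself q⟩, ?_⟩
    rw [Nat.card_eq_fintype_card]
    exact Nat.lt_succ_of_le (Finset.card_le_univ _)
  let pos : Q → Fin (Nat.card Q + 2) := fun q => ⟨(S q).card, by have := hcard q; omega⟩
  have hpos : ∀ a b, (a < b ∨ (a ∈ C₂ ∧ b ∈ C₁ ∧ ¬ b < a)) → pos a < pos b := fun a b hab =>
    Fin.lt_def.2 (Finset.card_lt_card (hS a b hab))
  let f : Q → P := fun q => if q ∈ C₁ then x (pos q) else v (pos q)
  have hf1 : ∀ q ∈ C₁, f q = x (pos q) := fun q hq => by simp [f, hq]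
  have hf2 : ∀ q ∈ C₂, f q = v (pos q) := fun q hq => by
    have : q ∉ C₁ := fun h => hdis q h hq
    simp [f, this]
  have hlt : ∀ a b, a < b → f a < f b := by
    intro a b hab
    have hp := hpos a b (Or.inl hab)
    by_cases ha : a ∈ C₁ <;> by_cases hb : b ∈ C₁
    · rw [hf1 a ha, hf1 b hb]; exact hx hp
    · rw [hf1 a ha, hf2 b (hmem b hb)]; exact hxv _ _ hp.le
    · exact absurd hab.le (hcross b hb a (hmem a ha))
    · rw [hf2 a (hmem a ha), hf2 b (hmem b hb)]; exact hv hp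
  have hincomp : ∀ a ∈ C₁, ∀ b ∈ C₂, ¬ a < b → Incomp (f a) (f b) := by
    intro a ha b hb hab
    rw [hf1 a ha, hf2 b hb]
    exact hinc _ _ (hpos b a (Or.inr ⟨hb, ha, hab⟩))
  have hle : ∀ a b, f a ≤ f b ↔ a ≤ b := by
    intro a b
    constructor
    · intro h
      by_contra hab
      have hnba : ¬ b < a := fun h' => absurd h (not_le_of_gt (hlt b a h'))
      by_cases ha : a ∈ C₁ <;> by_cases hb : b ∈ C₁
      · exact hnba (lt_of_le_not_ge ((h₁.total ha hb).resolve_left hab) hab)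
      · exact (hincomp a ha b (hmem b hb) (fun h' => hab h'.le)).1 h
      · exact (hincomp b hb a (hmem a ha) hnba).2 h
      · exact hnba (lt_of_le_not_ge ((h₂.total (hmem a ha) (hmem b hb)).resolve_left hab) hab)
    · intro h
      rcases h.eq_or_lt with rfl | h
      · exact le_rfl
      · exact (hlt a b h).le
  refine ⟨OrderEmbedding.ofMapLEIff f hle, x 0, v (Fin.last _), hxv _ _ (Fin.zero_le _), fun q => ?_⟩
  have h0 : (0 : Fin (Nat.card Q + 2)) < pos q := Fin.lt_def.2 (hcard q).1
  have h1 : pos q < Fin.last _ := Fin.lt_def.2 (hcard q).2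
  simp only [OrderEmbedding.coe_ofMapLEIff]
  by_cases hq : q ∈ C₁
  · rw [hf1 q hq]
    exact ⟨hx h0, hxv _ _ h1.le⟩
  · rw [hf2 q (hmem q hq)]
    exact ⟨hxv _ _ h0.le, hv h1⟩

/-- Every Grundy colouring of a finite poset of width at most `w` without a copy of `1 ⊕ Q ⊕ 1`
uses at most `N - 2` colours. With this normalization the bounds of two posets multiply under
series composition. -/
def ColourBound (Q : Type v) [PartialOrder Q] (w N : ℕ) : Prop :=
  ∀ (P : Type) [PartialOrder P] [Finite P] (g : P → ℕ), IsGrundy g → WidthLE P w →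
    ¬ HasBracketed Q P → (Set.range g).ncard + 1 < N

theorem ColourBound.two_le {Q : Type v} [PartialOrder Q] {w N : ℕ} (h : ColourBound Q w N) :
    2 ≤ N := by
  have := h Empty (fun _ => 0) ⟨fun x => x.elim, fun x => x.elim⟩
    (fun A _ => by simp [Finset.eq_empty_of_isEmpty]) (fun ⟨_, lo, _⟩ => lo.elim)
  omega

theorem IsLadderLike.colourBound {Q : Type v} [PartialOrder Q] [Finite Q] (hQ : IsLadderLike Q)
    [Nonempty Q] {w : ℕ} (hw : 2 ≤ w) :
    ColourBound Q w ((w ^ (16 * (Nat.log 2 w + 1))) ^ Nat.card Q) := by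
  intro P _ _ g hg hwP hP
  have hk := hg.ncard_range_le_of_not_hasLadder hwP (by omega)
    (m := Nat.card Q + 2) (fun h => hP (hQ.hasBracketed h))
  have hn : 1 ≤ Nat.card Q := Nat.card_pos
  set n := Nat.card Q
  set t := Nat.log 2 w + 1 with ht
  have hnw : n ≤ w ^ n := (Nat.lt_pow_self (by omega)).le
  have h4 : 4 ≤ w ^ 2 := by nlinarith
  have h10 : 10 ≤ w ^ 4 := by
    calc 10 ≤ 4 * 4 := by norm_num
      _ ≤ w ^ 2 * w ^ 2 := Nat.mul_le_mul h4 h4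
      _ = w ^ 4 := by ring
  have hm : w * (n + 2) + 1 ≤ w ^ 3 * w ^ n := by
    have h1 : 1 ≤ w * n := Nat.mul_pos (by omega) hn
    have h2 : w ≤ w * n := Nat.le_mul_of_pos_right _ hn
    calc w * (n + 2) + 1 ≤ 4 * (w * n) := by rw [mul_add]; omega
      _ ≤ w ^ 2 * (w * w ^ n) := Nat.mul_le_mul h4 (Nat.mul_le_mul_left _ hnw)
      _ = w ^ 3 * w ^ n := by ring
  have hA : 10 * w ^ 2 * (w * (n + 2) + 1) ^ 2 ≤ w ^ (14 * n) := by
    calc _ ≤ w ^ 4 * w ^ 2 * (w ^ 3 * w ^ n) ^ 2 :=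
          Nat.mul_le_mul (Nat.mul_le_mul_right _ h10) (Nat.pow_le_pow_left hm 2)
      _ = w ^ (12 + 2 * n) := by ring
      _ ≤ _ := Nat.pow_le_pow_right (by omega) (by omega)
  have hnt : 1 ≤ n * t := Nat.mul_pos hn (by omega)
  have h1 : (Set.range g).ncard ≤ w ^ (1 + 14 * (n * t)) := by
    calc _ ≤ w * (w ^ (14 * n)) ^ t := hk.trans (Nat.mul_le_mul_left _ (Nat.pow_le_pow_left hA _))
      _ = _ := by rw [← pow_mul, pow_add, pow_one, mul_assoc]
  have h2 : 2 ≤ w ^ (1 + 14 * (n * t)) :=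
    hw.trans (Nat.le_self_pow (by omega) w)
  calc (Set.range g).ncard + 1 < w ^ (1 + 14 * (n * t)) * 2 := by omega
    _ ≤ w ^ (1 + 14 * (n * t)) * w := Nat.mul_le_mul_left _ hw
    _ = w ^ (2 + 14 * (n * t)) := by ring
    _ ≤ w ^ (16 * (n * t)) := Nat.pow_le_pow_right (by omega) (by omega)
    _ = _ := by rw [← pow_mul]; congr 1; ring

section
variable {P : Type*} [PartialOrder P]

theorem WidthLE.subtype {w : ℕ} (hw : WidthLE P w) (p : P → Prop) : WidthLE {x // p x} w := by
  intro A hA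
  rw [← Finset.card_map (Function.Embedding.subtype p)]
  refine hw _ ?_
  intro x hx y hy hxy hle
  simp only [Finset.coe_map, Set.mem_image] at hx hy
  obtain ⟨x, hx, rfl⟩ := hx
  obtain ⟨y, hy, rfl⟩ := hy
  exact hA hx hy (fun h => hxy (by rw [h])) hle

theorem IsGrundy.subtype {g : P → ℕ} (hg : IsGrundy g) (p : P → Prop)
    (h : ∀ x y, p x → p y → g y < g x → ∃ z, p z ∧ g z = g y ∧ Incomp z x) :
    IsGrundy (fun x : {x // p x} => g x) where
  comparable x y hxy := hg.comparable x.1 y.1 hxy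
  witness x y hxy := by
    obtain ⟨z, hz, h1, h2⟩ := h x.1 y.1 x.2 y.2 hxy
    exact ⟨⟨z, hz⟩, h1, h2⟩

end

/-- If only the largest element of `A` may be missing from the range of `f`, then the range has at
least `A.card - 1` elements. -/
theorem card_le_ncard_range_add_one {α : Type*} [Finite α] (f : α → ℕ) (A : Finset ℕ)
    (h : ∀ i ∈ A, ∀ j ∈ A, i < j → i ∈ Set.range f) : A.card ≤ (Set.range f).ncard + 1 := by
  rcases A.eq_empty_or_nonempty with rfl | hA
  · simp
  have h1 : ((A.erase (A.max' hA) : Finset ℕ) : Set ℕ) ⊆ Set.range f := by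
    intro i hi
    have hi' := Finset.mem_erase.1 (Finset.mem_coe.1 hi)
    exact h i hi'.2 _ (A.max'_mem hA) (lt_of_le_of_ne (A.le_max' _ hi'.2) hi'.1)
  have h2 := Set.ncard_le_ncard h1 (Set.finite_range f)
  rw [Set.ncard_coe_finset, Finset.card_erase_of_mem (A.max'_mem hA)] at h2
  omega

theorem hasBracketed_series {Q₁ Q₂ Q : Type*} [PartialOrder Q₁] [PartialOrder Q₂]
    [PartialOrder Q] (e : Q ≃o Q₁ ⊕ₗ Q₂) {P : Type*} [PartialOrder P] {lo mid hi : P}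
    (f₁ : Q₁ ↪o P) (f₂ : Q₂ ↪o P) (hlm : lo < mid) (hmh : mid < hi)
    (h₁ : ∀ q, lo < f₁ q ∧ f₁ q < mid) (h₂ : ∀ q, mid < f₂ q ∧ f₂ q < hi) : HasBracketed Q P := by
  let F : Q₁ ⊕ₗ Q₂ → P := fun s => Sum.elim f₁ f₂ (ofLex s)
  have hF : ∀ a b, F a ≤ F b ↔ a ≤ b := by
    intro a b
    induction a using Lex.rec with | _ a
    induction b using Lex.rec with | _ b
    rcases a with a | a <;> rcases b with b | b
    · simp [F]
    · simpa [F] using ((h₁ a).2.trans (h₂ b).1).le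
    · simpa [F] using ((h₁ b).2.trans (h₂ a).1).not_ge
    · simp [F]
  refine ⟨e.toOrderEmbedding.trans (OrderEmbedding.ofMapLEIff F hF), lo, hi, hlm.trans hmh,
    fun q => ?_⟩
  have : ∀ s, lo < F s ∧ F s < hi := by
    intro s
    induction s using Lex.rec with | _ s
    rcases s with s | s
    · exact ⟨(h₁ s).1, (h₁ s).2.trans hmh⟩
    · exact ⟨hlm.trans (h₂ s).1, (h₂ s).2⟩
  exact this (e q)

/-- Bounds multiply under series composition. Let `P` have no copy of `1 ⊕ Q₁ ⊕ Q₂ ⊕ 1`. The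
down-set `D` of elements that are not above a copy of `1 ⊕ Q₁` has no copy of `1 ⊕ Q₁ ⊕ 1`, and its
complement has no copy of `1 ⊕ Q₂ ⊕ 1`. Write `i ≺ j` if `i < j` and some element of colour `j` in
`D` is above all elements of colour `i` in `D`, or there are no elements of colour `i` in `D`. This
is a strict order on the colours. The restriction of the colouring to an antichain of colours is a
Grundy colouring on `D`, and its restriction to a chain is one on the complement of `D`; in both
cases at most the largest colour is lost. -/
theorem ColourBound.series {Q₁ : Type u} {Q₂ : Type u} {Q : Type u} [PartialOrder Q₁]
    [PartialOrder Q₂] [PartialOrder Q] (e : Q ≃o Q₁ ⊕ₗ Q₂) {w N₁ N₂ : ℕ}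
    (h₁ : ColourBound Q₁ w N₁) (h₂ : ColourBound Q₂ w N₂) : ColourBound Q w (N₁ * N₂) := by
  classical
  intro P _ _ g hg hw hP
  by_contra hcon
  have hN₁ := h₁.two_le
  have hN₂ := h₂.two_le
  let D : P → Prop := fun x => ¬ ∃ (f : Q₁ ↪o P) (lo : P), lo < x ∧ ∀ q, lo < f q ∧ f q < x
  have hD : ∀ x y, x ≤ y → D y → D x := by
    rintro x y hxy hy ⟨f, lo, hlo, hf⟩
    exact hy ⟨f, lo, hlo.trans_le hxy, fun q => ⟨(hf q).1, (hf q).2.trans_le hxy⟩⟩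
  let r : ℕ → ℕ → Prop := fun i j => i < j ∧
    ((∀ y, g y = i → ¬ D y) ∨ ∃ x, g x = j ∧ D x ∧ ∀ y, g y = i → D y → y < x)
  have hfin : (Set.range g).Finite := Set.finite_range g
  have hcard : (N₁ - 1) * (N₂ - 1) < hfin.toFinset.card := by
    rw [← Set.ncard_eq_toFinset_card _ hfin]
    obtain ⟨a, rfl⟩ := Nat.exists_eq_add_of_le hN₁
    obtain ⟨b, rfl⟩ := Nat.exists_eq_add_of_le hN₂
    have h3 : (2 + a - 1) * (2 + b - 1) = (1 + a) * (1 + b) := by congr 1 <;> omega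
    have h4 : (1 + a) * (1 + b) + 2 < (2 + a) * (2 + b) := by ring_nf; omega
    omega
  have hir : ∀ i, ¬ r i i := fun i h => lt_irrefl _ h.1
  have htr : ∀ i j k, r i j → r j k → r i k := by
    rintro i j k ⟨hij, hij'⟩ ⟨hjk, hjk'⟩
    refine ⟨hij.trans hjk, ?_⟩
    rcases hij' with h | ⟨x, hx, hDx, hxi⟩
    · exact Or.inl h
    rcases hjk' with h | ⟨x', hx', hDx', hxj⟩
    · exact absurd hDx (h x hx)
    · exact Or.inr ⟨x', hx', hDx', fun y hy hDy => (hxi y hy hDy).trans (hxj x hx hDx)⟩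
  rcases exists_antichain_or_chain hir htr (N₁ - 1) (N₂ - 1) _ hcard with
    ⟨A, hA, hAc, hAr⟩ | ⟨C, hC, hCc, hCr⟩
  · let p : P → Prop := fun x => D x ∧ g x ∈ A
    have hp : IsGrundy (fun x : {x // p x} => g x) := by
      refine hg.subtype p fun x y hx hy hyx => ?_
      have hnr : ¬ r (g y) (g x) := hAr _ hy.2 _ hx.2
      simp only [r, not_and, not_or, not_exists, not_forall] at hnr
      obtain ⟨y', hy', hDy', hy'x⟩ := (hnr hyx).2 x rfl hx.1
      by_cases hle : x ≤ y'
      · obtain ⟨z, hz, hzx⟩ := hg.witness x y hyx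
        have hzy : z ≤ y' := (hg.comparable z y' (hz.trans hy'.symm)).elim id
          (fun h => absurd (hle.trans h) hzx.2)
        exact ⟨z, ⟨hD _ _ hzy hDy', by rw [hz]; exact hy.2⟩, hz, hzx⟩
      · refine ⟨y', ⟨hDy', by rw [hy']; exact hy.2⟩, hy', fun h => hy'x ?_, hle⟩
        exact lt_of_le_not_ge h hle
    have hb := h₁ {x // p x} _ hp (hw.subtype p) (by
      rintro ⟨f, lo, hi, hlh, hf⟩
      exact hi.2.1 ⟨f.trans (OrderEmbedding.subtype p), lo.1, hlh, hf⟩)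
    have hle := card_le_ncard_range_add_one (fun x : {x // p x} => g x) A (by
      intro i hi j hj hij
      have hnr := hAr i hi j hj
      simp only [r, not_and, not_or, not_forall, not_not] at hnr
      obtain ⟨y, hy, hDy⟩ := (hnr hij).1
      exact ⟨⟨y, hDy, by rw [hy]; exact hi⟩, hy⟩)
    omega
  · have hCr' : ∀ i ∈ C, ∀ j ∈ C, i < j → r i j := fun i hi j hj hij =>
      (hCr i hi j hj hij.ne).resolve_right fun h => lt_asymm hij h.1
    let p : P → Prop := fun x => ¬ D x ∧ g x ∈ C
    have hp : IsGrundy (fun x : {x // p x} => g x) := by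
      refine hg.subtype p fun x y hx hy hyx => ?_
      obtain ⟨z, hz, hzx⟩ := hg.witness x y hyx
      refine ⟨z, ⟨fun hDz => ?_, by rw [hz]; exact hy.2⟩, hz, hzx⟩
      rcases (hCr' _ hy.2 _ hx.2 hyx).2 with h | ⟨x', hx', hDx', h⟩
      · exact h z hz hDz
      · have : x' ≤ x := (hg.comparable _ _ hx').elim id (fun h' => absurd (hD _ _ h' hDx') hx.1)
        exact hzx.1 ((h z hz hDz).le.trans this)
    have hb := h₂ {x // p x} _ hp (hw.subtype p) (by
      rintro ⟨f, lo, hi, hlh, hf⟩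
      obtain ⟨f₁, lo₁, h, h'⟩ := not_not.1 lo.2.1
      exact hP (hasBracketed_series e f₁ (f.trans (OrderEmbedding.subtype p)) h hlh h' hf))
    have hle := card_le_ncard_range_add_one (fun x : {x // p x} => g x) C (by
      intro i hi j hj hij
      obtain ⟨y, hy⟩ : i ∈ Set.range g := by simpa using hC hi
      obtain ⟨_, h⟩ := hCr' i hi j hj hij
      rcases h with h | ⟨x, hx, hDx, h⟩
      · exact ⟨⟨y, h y hy, by rw [hy]; exact hi⟩, hy⟩
      · obtain ⟨z, hz, hzx⟩ := hg.witness x y (by omega)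
        exact ⟨⟨z, fun hDz => hzx.1 (h z (hz.trans hy) hDz).le, by rw [hz, hy]; exact hi⟩,
          hz.trans hy⟩)
    omega

theorem LadderSeriesFamily.finite {Q : Type u} [PartialOrder Q] (h : LadderSeriesFamily Q) :
    Finite Q := by
  induction h with
  | ladderLike Q h => assumption
  | series Q₁ Q₂ Q h₁ h₂ e ih₁ ih₂ =>
    have : Finite (Q₁ ⊕ₗ Q₂) := inferInstanceAs (Finite (Q₁ ⊕ Q₂))
    exact Finite.of_equiv _ e.symm.toEquiv

theorem ColourBound.of_embedding {Q Q' : Type u} [PartialOrder Q] [PartialOrder Q'] (e : Q ↪o Q')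
    {w N : ℕ} (h : ColourBound Q' w N) : ColourBound Q w N := fun P _ _ g hg hw hP =>
  h P g hg hw fun ⟨f, lo, hi, hlh, hf⟩ => hP ⟨e.trans f, lo, hi, hlh, fun q => hf (e q)⟩

theorem LadderSeriesFamily.colourBound {Q : Type u} [PartialOrder Q] (h : LadderSeriesFamily Q)
    {w : ℕ} (hw : 2 ≤ w) (hne : Nonempty Q) :
    ColourBound Q w ((w ^ (16 * (Nat.log 2 w + 1))) ^ Nat.card Q) := by
  induction h with
  | ladderLike Q h => exact h.colourBound hw
  | series Q₁ Q₂ Q h₁ h₂ e ih₁ ih₂ =>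
    have := h₁.finite
    have := h₂.finite
    have hcard : Nat.card Q = Nat.card Q₁ + Nat.card Q₂ := by
      rw [Nat.card_congr e.toEquiv, ← Nat.card_sum]; rfl
    -- the bound fails for empty posets, so empty components are discarded
    rcases isEmpty_or_nonempty Q₁ with hQ₁ | hQ₁
    · have e' : Q ≃o Q₂ := e.trans OrderIso.emptySumLex
      rw [Nat.card_congr e'.toEquiv]
      exact (ih₂ (e'.toEquiv.nonempty_congr.1 hne)).of_embedding e'.toOrderEmbedding
    rcases isEmpty_or_nonempty Q₂ with hQ₂ | hQ₂
    · have e' : Q ≃o Q₁ := e.trans OrderIso.sumLexEmpty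
      rw [Nat.card_congr e'.toEquiv]
      exact (ih₁ (e'.toEquiv.nonempty_congr.1 hne)).of_embedding e'.toOrderEmbedding
    rw [hcard, pow_add]
    exact ColourBound.series e (ih₁ hQ₁) (ih₂ hQ₂)

/-! ### First-Fit and Grundy colourings -/

section
variable {P : Type u} [PartialOrder P]

theorem exists_mem_firstFitInsert (x y : P) (Cs : List (Set P)) :
    (∃ C ∈ firstFitInsert x Cs, y ∈ C) ↔ y = x ∨ ∃ C ∈ Cs, y ∈ C := by
  induction Cs with
  | nil => simp [firstFitInsert]
  | cons C Cs ih =>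
    rw [firstFitInsert]
    split_ifs
    · simp only [List.exists_mem_cons_iff, Set.mem_insert_iff, or_assoc]
    · rw [List.exists_mem_cons_iff, List.exists_mem_cons_iff, ih]
      tauto

theorem exists_incomp_of_not_isChain_insert {x : P} {C : Set P} (hC : IsChain (· ≤ ·) C)
    (h : ¬ IsChain (· ≤ ·) (insert x C)) : ∃ z ∈ C, Incomp z x := by
  by_contra hcon
  refine h (hC.insert fun b hb _ => ?_)
  by_contra hb'
  exact hcon ⟨b, hb, fun h => hb' (Or.inr h), fun h => hb' (Or.inl h)⟩

/-- The invariant of First-Fit: the chains are nonempty and disjoint, and each element of a chain is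
incomparable to some element of each earlier chain. -/
def IsGreedyList (Cs : List (Set P)) : Prop :=
  (∀ C ∈ Cs, C.Nonempty ∧ IsChain (· ≤ ·) C) ∧
    Cs.Pairwise (fun C C' => ∀ x ∈ C', x ∉ C ∧ ∃ z ∈ C, Incomp z x)

theorem IsGreedyList.firstFitInsert {Cs : List (Set P)} (h : IsGreedyList Cs) {x : P}
    (hx : ∀ C ∈ Cs, x ∉ C) : IsGreedyList (firstFitInsert x Cs) := by
  induction Cs with
  | nil => simp [_root_.firstFitInsert, IsGreedyList]
  | cons C Cs ih =>
    obtain ⟨h1, h2⟩ := h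
    rw [List.pairwise_cons] at h2
    rw [List.forall_mem_cons] at h1 hx
    rw [_root_.firstFitInsert]
    split_ifs with hc
    · refine ⟨List.forall_mem_cons.2 ⟨⟨Set.insert_nonempty _ _, hc⟩, h1.2⟩,
        List.pairwise_cons.2 ⟨fun C' hC' y hy => ?_, h2.2⟩⟩
      obtain ⟨h3, z, hz, hzy⟩ := h2.1 C' hC' y hy
      refine ⟨?_, z, Set.mem_insert_of_mem _ hz, hzy⟩
      rintro (rfl | h)
      · exact hx.2 C' hC' hy
      · exact h3 h
    · have := ih ⟨h1.2, h2.2⟩ hx.2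
      refine ⟨List.forall_mem_cons.2 ⟨h1.1, this.1⟩,
        List.pairwise_cons.2 ⟨fun C' hC' y hy => ?_, this.2⟩⟩
      rcases (exists_mem_firstFitInsert x y Cs).1 ⟨C', hC', hy⟩ with rfl | ⟨C'', hC'', hy'⟩
      · exact ⟨hx.1, exists_incomp_of_not_isChain_insert h1.1.2 hc⟩
      · exact h2.1 C'' hC'' y hy'

theorem isGreedyList_firstFit (l : List P) (hl : l.Nodup) :
    IsGreedyList (firstFit l) ∧ ∀ y, (∃ C ∈ firstFit l, y ∈ C) ↔ y ∈ l := by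
  induction l using List.reverseRecOn with
  | nil => simp [firstFit, IsGreedyList]
  | append_singleton l x ih =>
    have h1 : firstFit (l ++ [x]) = firstFitInsert x (firstFit l) := by simp [firstFit]
    have h2 := List.nodup_append.1 hl
    obtain ⟨h3, h4⟩ := ih h2.1
    rw [h1]
    refine ⟨h3.firstFitInsert fun C hC hx => ?_, fun y => ?_⟩
    · exact h2.2.2 x ((h4 x).1 ⟨C, hC, hx⟩) x (by simp) rfl
    · rw [exists_mem_firstFitInsert, h4]; simp [or_comm]

/-- The chains produced by First-Fit are the colour classes of a Grundy colouring. -/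
theorem exists_isGrundy_of_isPresentationOrder {l : List P} (hl : IsPresentationOrder l) :
    ∃ g : P → ℕ, IsGrundy g ∧ (Set.range g).ncard = (firstFit l).length := by
  obtain ⟨⟨h1, h2⟩, h3⟩ := isGreedyList_firstFit l hl.1
  rw [List.pairwise_iff_getElem] at h2
  have h4 : ∀ y, ∃ i, ∃ h : i < (firstFit l).length, y ∈ (firstFit l)[i] := fun y => by
    obtain ⟨C, hC, hy⟩ := (h3 y).2 (hl.2 y)
    obtain ⟨i, hi, rfl⟩ := List.getElem_of_mem hC
    exact ⟨i, hi, hy⟩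
  choose g hg hgm using h4
  have huniq : ∀ y i (h : i < (firstFit l).length), y ∈ (firstFit l)[i] → g y = i := by
    intro y i h hy
    rcases lt_trichotomy (g y) i with hlt | heq | hlt
    · exact absurd (hgm y) (h2 _ _ (hg y) h hlt y hy).1
    · exact heq
    · exact absurd hy (h2 _ _ h (hg y) hlt y (hgm y)).1
  refine ⟨g, ⟨fun x y hxy => ?_, fun x y hyx => ?_⟩, ?_⟩
  · refine (h1 _ (List.getElem_mem (hg x))).2.total (hgm x) ?_
    simp only [hxy]
    exact hgm y
  · obtain ⟨-, z, hz, hzx⟩ := h2 _ _ (hg y) (hg x) hyx x (hgm x)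
    exact ⟨z, huniq z _ _ hz, hzx⟩
  · have : Set.range g = Set.Iio (firstFit l).length := by
      ext i
      constructor
      · rintro ⟨y, rfl⟩; exact hg y
      · intro hi
        obtain ⟨y, hy⟩ := (h1 _ (List.getElem_mem hi)).1
        exact ⟨y, huniq y i hi hy⟩
    rw [this, ← Finset.coe_Iio, Set.ncard_coe_finset, Nat.card_Iio]

theorem firstFitInsert_append_of_blocked {x : P} {Cs : List (Set P)}
    (h : ∀ C ∈ Cs, ∃ z ∈ C, Incomp z x) (Ds : List (Set P)) :
    firstFitInsert x (Cs ++ Ds) = Cs ++ firstFitInsert x Ds := by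
  induction Cs with
  | nil => rfl
  | cons C Cs ih =>
    rw [List.forall_mem_cons] at h
    have hC : ¬ IsChain (· ≤ ·) (insert x C) := fun hc => by
      obtain ⟨z, hz, hzx⟩ := h.1
      rcases hc.total (Set.mem_insert_of_mem _ hz) (Set.mem_insert x C) with h | h
      · exact hzx.1 h
      · exact hzx.2 h
    rw [List.cons_append, firstFitInsert, if_neg hC, ih h.2, List.cons_append]

theorem foldl_firstFitInsert_of_blocked {Cs : List (Set P)} (l : List P) (S : Set P)
    (hS : IsChain (· ≤ ·) (S ∪ {x | x ∈ l})) (h : ∀ x ∈ l, ∀ C ∈ Cs, ∃ z ∈ C, Incomp z x) :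
    l.foldl (fun Cs x => firstFitInsert x Cs) (Cs ++ [S]) = Cs ++ [S ∪ {x | x ∈ l}] := by
  induction l generalizing S with
  | nil => simp
  | cons x l ih =>
    have h1 : S ∪ {y | y ∈ x :: l} = insert x S ∪ {y | y ∈ l} := by
      ext y; simp only [Set.mem_union, Set.mem_ofPred_eq, List.mem_cons, Set.mem_insert_iff]; tauto
    rw [h1] at hS ⊢
    have h2 : firstFitInsert x (Cs ++ [S]) = Cs ++ [insert x S] := by
      rw [firstFitInsert_append_of_blocked (h x (by simp)), firstFitInsert,
        if_pos (hS.mono Set.subset_union_left)]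
    rw [List.foldl_cons, h2]
    exact ih _ hS fun y hy => h y (by simp [hy])

theorem foldl_firstFitInsert_new {Cs : List (Set P)} (l : List P) (hl : l ≠ [])
    (hS : IsChain (· ≤ ·) {x | x ∈ l}) (h : ∀ x ∈ l, ∀ C ∈ Cs, ∃ z ∈ C, Incomp z x) :
    l.foldl (fun Cs x => firstFitInsert x Cs) Cs = Cs ++ [{x | x ∈ l}] := by
  obtain ⟨x, l, rfl⟩ := List.exists_cons_of_ne_nil hl
  have h1 : {y | y ∈ x :: l} = {x} ∪ {y | y ∈ l} := by
    ext y; simp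
  have h2 : firstFitInsert x Cs = Cs ++ [{x}] := by
    have := firstFitInsert_append_of_blocked (h x (by simp)) []
    rwa [List.append_nil, firstFitInsert] at this
  rw [h1] at hS ⊢
  rw [List.foldl_cons, h2]
  exact foldl_firstFitInsert_of_blocked l {x} hS fun y hy => h y (by simp [hy])

/-- Presenting the elements colour by colour makes First-Fit reproduce a given Grundy colouring. -/
theorem IsGrundy.exists_isPresentationOrder [Finite P] {g : P → ℕ} (hg : IsGrundy g) {q : ℕ}
    (hq : Set.range g = Set.Iio q) :
    ∃ l : List P, IsPresentationOrder l ∧ (firstFit l).length = q := by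
  classical
  have := Fintype.ofFinite P
  have key : ∀ k ≤ q, ∃ l : List P, l.Nodup ∧ (∀ x, x ∈ l ↔ g x < k) ∧
      firstFit l = (List.range k).map (fun i => {x | g x = i}) := by
    intro k
    induction k with
    | zero => exact fun _ => ⟨[], by simp, by simp, by simp [firstFit]⟩
    | succ k ih =>
      intro hk
      obtain ⟨l, hl1, hl2, hl3⟩ := ih (by omega)
      let l' := (Finset.univ.filter (fun x => g x = k)).toList
      have hl' : ∀ x, x ∈ l' ↔ g x = k := fun x => by simp [l']
      have hset : {x | x ∈ l'} = {x | g x = k} := by ext x; simp [hl']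
      refine ⟨l ++ l', ?_, fun x => ?_, ?_⟩
      · rw [List.nodup_append]
        refine ⟨hl1, Finset.nodup_toList _, ?_⟩
        rintro a ha b hb rfl
        have h1 := (hl2 a).1 ha
        have h2 := (hl' a).1 hb
        omega
      · rw [List.mem_append, hl2, hl']; omega
      · have h1 : firstFit (l ++ l') =
            l'.foldl (fun Cs x => firstFitInsert x Cs) (firstFit l) := by
          simp only [firstFit, List.foldl_append]
        rw [h1, foldl_firstFitInsert_new, hset, hl3, List.range_succ, List.map_append]
        · rfl
        · obtain ⟨x, hx⟩ : k ∈ Set.range g := by rw [hq]; exact hk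
          exact List.ne_nil_of_mem ((hl' x).2 hx)
        · rw [hset]
          exact fun x hx y hy _ => hg.comparable x y (hx.trans hy.symm)
        · intro x hx C hC
          rw [hl3, List.mem_map] at hC
          obtain ⟨i, hi, rfl⟩ := hC
          rw [List.mem_range] at hi
          obtain ⟨y, rfl⟩ : i ∈ Set.range g := by rw [hq]; exact hi.trans hk
          rw [hl'] at hx
          exact hg.witness x y (by omega)
  obtain ⟨l, h1, h2, h3⟩ := key q le_rfl
  refine ⟨l, ⟨h1, fun x => (h2 x).2 ?_⟩, by simp [h3]⟩
  have : g x ∈ Set.range g := ⟨x, rfl⟩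
  rwa [hq] at this

end

/-! ### The upper bound -/

theorem widthLE_of_posetWidth_le {P : Type u} [PartialOrder P] {w : ℕ}
    (h : posetWidth P ≤ (w : ℕ∞)) : WidthLE P w := by
  intro A hA
  have h1 : (A : Set P).encard ≤ posetWidth P :=
    le_iSup₂ (f := fun (A : Set P) (_ : IsAntichain (· ≤ ·) A) => A.encard) (A : Set P) hA
  rw [Set.encard_coe_eq_coe_finsetCard] at h1
  exact_mod_cast h1.trans h

theorem FF_le_of_forall_isGrundy {Q : Type v} [PartialOrder Q] {w M : ℕ}
    (h : ∀ (P : Type) [PartialOrder P] [Finite P] (g : P → ℕ), IsGrundy g → WidthLE P w →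
      IsFree Q P → (Set.range g).ncard ≤ M) : FF w Q ≤ (M : ℕ∞) := by
  refine sSup_le ?_
  rintro k ⟨P, _, _, l, hw, hQ, hl, rfl⟩
  obtain ⟨g, hg, hgl⟩ := exists_isGrundy_of_isPresentationOrder hl
  rw [← hgl]
  exact_mod_cast h P g hg (widthLE_of_posetWidth_le hw.le) hQ

theorem IsGrundy.ncard_range_le_one {P : Type u} [PartialOrder P] [Finite P] (hw : WidthLE P 1)
    {g : P → ℕ} (hg : IsGrundy g) : (Set.range g).ncard ≤ 1 := by
  classical
  refine (Set.ncard_le_one (Set.finite_range g)).2 ?_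
  have key : ∀ x y, ¬ g y < g x := fun x y hyx => by
    obtain ⟨z, -, hzx⟩ := hg.witness x y hyx
    have := hw {z, x} (by
      rw [Finset.coe_pair]
      exact Set.pairwise_pair.2 fun _ => ⟨hzx.1, hzx.2⟩)
    rw [Finset.card_pair hzx.ne] at this
    omega
  rintro _ ⟨x, rfl⟩ _ ⟨y, rfl⟩
  have h1 := key x y
  have h2 := key y x
  omega

theorem nonempty_of_posetWidth_eq_two {Q : Type u} [PartialOrder Q] (h : posetWidth Q = 2) :
    Nonempty Q := by
  by_contra hcon
  rw [not_nonempty_iff] at hcon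
  have : posetWidth Q ≤ 0 := iSup₂_le fun A _ => by
    rw [Set.eq_empty_of_isEmpty A, Set.encard_empty]
  rw [h] at this
  exact absurd this (by norm_num)

theorem pow_log_le_rpow {w n : ℕ} (hw : 2 ≤ w) :
    (((w ^ (16 * (Nat.log 2 w + 1))) ^ n : ℕ) : ℝ) ≤
      (2 : ℝ) ^ (32 * (n : ℝ) * (Real.logb 2 (w : ℝ)) ^ 2) := by
  have hw0 : (0 : ℝ) < w := by exact_mod_cast (by omega : 0 < w)
  have hL1 : 1 ≤ Real.logb 2 (w : ℝ) := by
    rw [Real.le_logb_iff_rpow_le (by norm_num) hw0, Real.rpow_one]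
    exact_mod_cast hw
  have hlog : ((Nat.log 2 w : ℕ) : ℝ) ≤ Real.logb 2 (w : ℝ) := by
    exact_mod_cast Real.natLog_le_logb w 2
  set L := Real.logb 2 (w : ℝ) with hL
  have hwL : (w : ℝ) = (2 : ℝ) ^ L := by
    rw [hL, Real.rpow_logb (by norm_num) (by norm_num) hw0]
  rw [← pow_mul]
  push_cast
  rw [hwL, ← Real.rpow_natCast, ← Real.rpow_mul (by norm_num)]
  refine Real.rpow_le_rpow_of_exponent_le (by norm_num) ?_
  push_cast
  have h1 : ((Nat.log 2 w : ℕ) : ℝ) + 1 ≤ 2 * L := by linarith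
  have hn : (0 : ℝ) ≤ n := Nat.cast_nonneg n
  calc L * (16 * (((Nat.log 2 w : ℕ) : ℝ) + 1) * n)
      ≤ L * (16 * (2 * L) * n) := by gcongr
    _ = 32 * n * L ^ 2 := by ring

theorem FF_eq_and_le_of_ladderSeriesFamily {Q : Type u} [PartialOrder Q]
    (hQ : posetWidth Q = 2) (h : LadderSeriesFamily Q) {w : ℕ} (hw : 1 ≤ w) :
    ∃ m : ℕ, FF w Q = (m : ℕ∞) ∧
      (m : ℝ) ≤ (2 : ℝ) ^ (32 * (Nat.card Q : ℝ) * (Real.logb 2 (w : ℝ)) ^ 2) := by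
  suffices hM : ∃ M : ℕ, FF w Q ≤ (M : ℕ∞) ∧
      (M : ℝ) ≤ (2 : ℝ) ^ (32 * (Nat.card Q : ℝ) * (Real.logb 2 (w : ℝ)) ^ 2) by
    obtain ⟨M, hM, hM'⟩ := hM
    obtain ⟨m, hm, hmM⟩ := ENat.le_natCast_iff.1 hM
    exact ⟨m, hm, le_trans (by exact_mod_cast hmM) hM'⟩
  rcases hw.eq_or_lt with rfl | hw
  · exact ⟨1, FF_le_of_forall_isGrundy fun P _ _ g hg hP _ => hg.ncard_range_le_one hP, by simp⟩
  · refine ⟨_, FF_le_of_forall_isGrundy fun P _ _ g hg hP hfree => ?_, pow_log_le_rpow hw⟩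
    have := h.colourBound hw (nonempty_of_posetWidth_eq_two hQ) P g hg hP
      fun ⟨f, _⟩ => hfree ⟨f⟩
    omega

/-! ### The lower bound -/

theorem LadderSeriesFamily.of_split {Q : Type u} [PartialOrder Q] (p : Q → Prop)
    (hp : ∀ x y, p x → ¬ p y → x < y) (h₁ : LadderSeriesFamily {x // p x})
    (h₂ : LadderSeriesFamily {x // ¬ p x}) : LadderSeriesFamily Q := by
  classical
  let F : {x // p x} ⊕ₗ {x // ¬ p x} → Q := fun s => Sum.elim Subtype.val Subtype.val (ofLex s)
  have hF : ∀ a b, F a ≤ F b ↔ a ≤ b := by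
    intro a b
    induction a using Lex.rec with | _ a
    induction b using Lex.rec with | _ b
    rcases a with a | a <;> rcases b with b | b
    · simp [F]
    · simpa [F] using (hp a b a.2 b.2).le
    · simpa [F] using (hp b a b.2 a.2).not_ge
    · simp [F]
  have hsurj : Function.Surjective F := fun q => by
    by_cases hq : p q
    · exact ⟨toLex (Sum.inl ⟨q, hq⟩), rfl⟩
    · exact ⟨toLex (Sum.inr ⟨q, hq⟩), rfl⟩
  exact .series _ _ Q h₁ h₂
    (RelIso.ofSurjective (OrderEmbedding.ofMapLEIff F hF) hsurj).symm

/-- The carrier of the next level over a poset with a colouring `g` by `a` colours: a chain of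
rungs `0, …, a`, and a stack of blocks `0, …, a`, where block `0` is a full copy of `P` and block
`i > 0` is the copy of the elements of colour less than `i`. -/
def Tower {P : Type u} (g : P → ℕ) (a : ℕ) : Type u :=
  {b : Fin (a + 1) × P // b.1 = 0 ∨ g b.2 < b.1} ⊕ Fin (a + 1)

namespace Tower

variable {P : Type u} {g : P → ℕ} {a : ℕ}

instance [Finite P] : Finite (Tower g a) := by
  unfold Tower; infer_instance

/-- The copy of `x` in block `i`. -/
def block (i : Fin (a + 1)) (x : P) (h : i = 0 ∨ g x < i) : Tower g a := Sum.inl ⟨(i, x), h⟩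

/-- The `j`-th rung. -/
def rung (g : P → ℕ) (j : Fin (a + 1)) : Tower g a := Sum.inr j

theorem cases (t : Tower g a) : (∃ i x h, t = block i x h) ∨ ∃ j, t = rung g j := by
  rcases t with ⟨⟨i, x⟩, h⟩ | j
  · exact Or.inl ⟨i, x, h, rfl⟩
  · exact Or.inr ⟨j, rfl⟩

/-- The colouring of the next level: block `0` uses the colours `a, …, 2 * a - 1`, the other blocks
keep the colours of `P`, rung `j < a` has colour `j`, and rung `a` has the new largest colour. -/
def colour (g : P → ℕ) (a : ℕ) : Tower g a → ℕ
  | Sum.inl b => if b.1.1 = 0 then a + g b.1.2 else g b.1.2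
  | Sum.inr j => if (j : ℕ) = a then 2 * a else j

theorem colour_block {i : Fin (a + 1)} {x : P} {hx : i = 0 ∨ g x < i} :
    colour g a (block i x hx) = if i = 0 then a + g x else g x := rfl

theorem colour_rung {j : Fin (a + 1)} :
    colour g a (rung g j) = if (j : ℕ) = a then 2 * a else (j : ℕ) := rfl

variable [PartialOrder P]

/-- Blocks and rungs are stacked with decreasing index, and block `i` is below rung `j` exactly if
`j < i`; a rung is never below an element of a block. -/
instance : PartialOrder (Tower g a) where
  le
    | Sum.inl b, Sum.inl c => c.1.1 < b.1.1 ∨ (b.1.1 = c.1.1 ∧ b.1.2 ≤ c.1.2)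
    | Sum.inl b, Sum.inr j => j < b.1.1
    | Sum.inr _, Sum.inl _ => False
    | Sum.inr i, Sum.inr j => j ≤ i
  le_refl t := by rcases t with b | j <;> simp
  le_trans s t u hst htu := by
    rcases s with s | s <;> rcases t with t | t <;> rcases u with u | u <;>
      simp only at hst htu ⊢
    · rcases hst with h | h <;> rcases htu with h' | h'
      · exact Or.inl (h'.trans h)
      · exact Or.inl (h'.1 ▸ h)
      · exact Or.inl (h.1 ▸ h')
      · exact Or.inr ⟨h.1.trans h'.1, h.2.trans h'.2⟩
    · rcases hst with h | h
      · exact htu.trans h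
      · exact h.1 ▸ htu
    · exact lt_of_le_of_lt htu hst
    · exact htu.trans hst
  le_antisymm s t hst hts := by
    rcases s with s | s <;> rcases t with t | t <;> simp only at hst hts
    · congr 1
      rcases hst with h | h <;> rcases hts with h' | h'
      · exact absurd h (lt_asymm h')
      · exact absurd h'.1 h.ne
      · exact absurd h.1 h'.ne
      · exact Subtype.ext (Prod.ext h.1 (h.2.antisymm h'.2))
    · congr 1
      exact hts.antisymm hst

theorem block_le_block {i j : Fin (a + 1)} {x y : P} {hx : i = 0 ∨ g x < i}
    {hy : j = 0 ∨ g y < j} : block i x hx ≤ block j y hy ↔ j < i ∨ (i = j ∧ x ≤ y) := Iff.rfl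

theorem block_le_rung {i j : Fin (a + 1)} {x : P} {hx : i = 0 ∨ g x < i} :
    block i x hx ≤ rung g j ↔ j < i := Iff.rfl

theorem not_rung_le_block {i j : Fin (a + 1)} {x : P} {hx : i = 0 ∨ g x < i} :
    ¬ rung g j ≤ block i x hx := fun h => h

theorem rung_le_rung {i j : Fin (a + 1)} : rung (P := P) g i ≤ rung g j ↔ j ≤ i := Iff.rfl

theorem incomp_block_block {i : Fin (a + 1)} {x y : P} {hx : i = 0 ∨ g x < i}
    {hy : i = 0 ∨ g y < i} : Incomp (block i x hx) (block i y hy) ↔ Incomp x y := by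
  simp [Incomp, IncompRel, block_le_block]

theorem incomp_block_rung {i j : Fin (a + 1)} {x : P} {hx : i = 0 ∨ g x < i} :
    Incomp (block i x hx) (rung g j) ↔ i ≤ j := by
  simp [Incomp, IncompRel, block_le_rung, not_rung_le_block]

/-- Each element has a witness in every smaller colour: an element of block `0` is incomparable to
all rungs, and rung `j` is incomparable to block `j` (and to block `0`). -/
theorem exists_colour_eq_and_incomp (hg : IsGrundy g) (hr : Set.range g = Set.Iio a)
    (t : Tower g a) {c : ℕ} (hc : c < colour g a t) : ∃ z, colour g a z = c ∧ Incomp z t := by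
  have hex : ∀ c < a, ∃ z, g z = c := fun c hc => by
    have : c ∈ Set.range g := by rw [hr]; exact hc
    exact this
  have hlt : ∀ x, g x < a := fun x => by
    have : g x ∈ Set.range g := ⟨x, rfl⟩
    rwa [hr] at this
  have hwit : ∀ x, ∀ c < g x, ∃ z, g z = c ∧ Incomp z x := fun x c hc => by
    obtain ⟨y, rfl⟩ := hex c (hc.trans (hlt x))
    exact hg.witness x y hc
  rcases t.cases with ⟨i, x, hx, rfl⟩ | ⟨j, rfl⟩
  · by_cases hi : i = 0
    · subst hi
      rw [colour_block, if_pos rfl] at hc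
      by_cases hca : c < a
      · refine ⟨rung g ⟨c, by omega⟩, ?_, (incomp_block_rung.2 (Fin.zero_le _)).symm⟩
        rw [colour_rung, if_neg (by simp only; omega)]
      · obtain ⟨z, hz, hzx⟩ := hwit x (c - a) (by omega)
        refine ⟨block 0 z (Or.inl rfl), ?_, incomp_block_block.2 hzx⟩
        rw [colour_block, if_pos rfl]; omega
    · rw [colour_block, if_neg hi] at hc
      obtain ⟨z, hz, hzx⟩ := hwit x c hc
      have hxi := hx.resolve_left hi
      refine ⟨block i z (Or.inr (by omega)), ?_, incomp_block_block.2 hzx⟩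
      rw [colour_block, if_neg hi, hz]
  · rw [colour_rung] at hc
    by_cases hca : c < a
    · have hcj : c < j := by
        split_ifs at hc <;> omega
      obtain ⟨z, hz⟩ := hex c hca
      have hj0 : j ≠ 0 := fun h => by simp [h] at hcj
      refine ⟨block j z (Or.inr (by omega)), ?_, incomp_block_rung.2 le_rfl⟩
      rw [colour_block, if_neg hj0, hz]
    · have hj := j.2
      obtain ⟨z, hz⟩ := hex (c - a) (by split_ifs at hc <;> omega)
      refine ⟨block 0 z (Or.inl rfl), ?_, incomp_block_rung.2 (Fin.zero_le _)⟩
      rw [colour_block, if_pos rfl, hz]; omega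

theorem isGrundy_colour (hg : IsGrundy g) (hr : Set.range g = Set.Iio a) :
    IsGrundy (colour g a) where
  witness x y hyx := exists_colour_eq_and_incomp hg hr x hyx
  comparable s t hst := by
    have hlt : ∀ x, g x < a := fun x => by
      have : g x ∈ Set.range g := ⟨x, rfl⟩
      rwa [hr] at this
    have hbr : ∀ i x hx j, colour g a (block i x hx) = colour g a (rung g j) →
        block i x hx ≤ rung g j := by
      intro i x hx j h
      rw [block_le_rung]
      rw [colour_block, colour_rung] at h
      have hx' := hlt x
      have hj := j.2
      rw [Fin.lt_def]
      split_ifs at h with h1 h2 h2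
      · omega
      · omega
      · omega
      · have := hx.resolve_left h1; omega
    rcases s.cases with ⟨i, x, hx, rfl⟩ | ⟨j, rfl⟩ <;>
      rcases t.cases with ⟨i', y, hy, rfl⟩ | ⟨j', rfl⟩
    · rcases lt_trichotomy i i' with h | h | h
      · exact Or.inr (block_le_block.2 (Or.inl h))
      · subst h
        have : g x = g y := by
          simp only [colour_block] at hst
          split_ifs at hst <;> omega
        exact (hg.comparable x y this).imp (fun h => block_le_block.2 (Or.inr ⟨rfl, h⟩))
          (fun h => block_le_block.2 (Or.inr ⟨rfl, h⟩))
      · exact Or.inl (block_le_block.2 (Or.inl h))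
    · exact Or.inl (hbr _ _ _ _ hst)
    · exact Or.inr (hbr _ _ _ _ hst.symm)
    · exact le_total j' j

theorem range_colour (hg : IsGrundy g) (hr : Set.range g = Set.Iio a) :
    Set.range (colour g a) = Set.Iio (2 * a + 1) := by
  have hlt : ∀ x, g x < a := fun x => by
    have : g x ∈ Set.range g := ⟨x, rfl⟩
    rwa [hr] at this
  have htop : colour g a (rung g (Fin.last a)) = 2 * a := by simp [colour_rung]
  ext c
  constructor
  · rintro ⟨t, rfl⟩
    rw [Set.mem_Iio]
    rcases t.cases with ⟨i, x, hx, rfl⟩ | ⟨j, rfl⟩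
    · have := hlt x
      rw [colour_block]; split_ifs <;> omega
    · have := j.2
      rw [colour_rung]; split_ifs <;> omega
  · intro hc
    rw [Set.mem_Iio] at hc
    rcases (Nat.lt_succ_iff.1 hc).eq_or_lt with rfl | hc
    · exact ⟨_, htop⟩
    · obtain ⟨z, hz, -⟩ := exists_colour_eq_and_incomp hg hr (rung g (Fin.last a)) (htop ▸ hc)
      exact ⟨z, hz⟩

/-- An antichain of the tower meets only one block, in an antichain of `P`, and at most one rung. -/
theorem widthLE {w : ℕ} (hw : WidthLE P w) : WidthLE (Tower g a) (w + 1) := by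
  classical
  intro A hA
  let A' : Finset ({b : Fin (a + 1) × P // b.1 = 0 ∨ g b.2 < b.1} ⊕ Fin (a + 1)) := A
  have hmem : ∀ t : Tower g a, t ∈ A' → t ∈ A := fun t ht => ht
  have hcard : A'.toLeft.card + A'.toRight.card = A.card := A'.card_toLeft_add_card_toRight
  have hl : A'.toLeft.card ≤ w := by
    have hne : ∀ b ∈ A'.toLeft, ∀ c ∈ A'.toLeft, b ≠ c → ¬ b.1.2 ≤ c.1.2 := by
      intro b hb c hc hbc hle
      rw [Finset.mem_toLeft] at hb hc
      have h1 : ¬ (c.1.1 < b.1.1 ∨ (b.1.1 = c.1.1 ∧ b.1.2 ≤ c.1.2)) :=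
        hA (hmem _ hb) (hmem _ hc) (fun h => hbc (Sum.inl_injective h))
      have h2 : ¬ (b.1.1 < c.1.1 ∨ (c.1.1 = b.1.1 ∧ c.1.2 ≤ b.1.2)) :=
        hA (hmem _ hc) (hmem _ hb) (fun h => hbc (Sum.inl_injective h).symm)
      rcases lt_trichotomy b.1.1 c.1.1 with h | h | h
      · exact h2 (Or.inl h)
      · exact h1 (Or.inr ⟨h, hle⟩)
      · exact h1 (Or.inl h)
    have hinj : Set.InjOn (fun b : {b : Fin (a + 1) × P // b.1 = 0 ∨ g b.2 < b.1} => b.1.2)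
        A'.toLeft := fun b hb c hc hbc => by
      by_contra h
      exact hne b hb c hc h (le_of_eq hbc)
    rw [← Finset.card_image_of_injOn hinj]
    refine hw _ ?_
    intro x hx y hy hxy
    rw [Finset.coe_image] at hx hy
    obtain ⟨b, hb, rfl⟩ := hx
    obtain ⟨c, hc, rfl⟩ := hy
    exact hne b hb c hc fun h => hxy (by rw [h])
  have hr : A'.toRight.card ≤ 1 := by
    refine Finset.card_le_one.2 fun i hi j hj => ?_
    rw [Finset.mem_toRight] at hi hj
    by_contra hij
    have h1 : ¬ j ≤ i := hA (hmem _ hi) (hmem _ hj) (fun h => hij (Sum.inr_injective h))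
    have h2 : ¬ i ≤ j := hA (hmem _ hj) (hmem _ hi) (fun h => hij (Sum.inr_injective h).symm)
    omega
  omega

theorem exists_antichain {A : Finset P} (hA : IsAntichain (· ≤ ·) (A : Set P)) :
    ∃ B : Finset (Tower g a), IsAntichain (· ≤ ·) (B : Set (Tower g a)) ∧
      B.card = A.card + 1 := by
  classical
  let f : P → Tower g a := fun x => block 0 x (Or.inl rfl)
  have hf : ∀ x y, f x ≤ f y ↔ x ≤ y := fun x y => by simp [f, block_le_block]
  have hinc : ∀ x, Incomp (f x) (rung g 0) := fun x => incomp_block_rung.2 le_rfl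
  have hinj : Function.Injective f := fun x y hxy =>
    ((hf x y).1 hxy.le).antisymm ((hf y x).1 hxy.ge)
  refine ⟨insert (rung g 0) (A.image f), ?_, ?_⟩
  · rw [Finset.coe_insert, Finset.coe_image]
    refine IsAntichain.insert ?_ ?_ ?_
    · rintro _ ⟨x, hx, rfl⟩ _ ⟨y, hy, rfl⟩ hxy hle
      exact hA hx hy (fun h => hxy (by rw [h])) ((hf x y).1 hle)
    · rintro _ ⟨x, hx, rfl⟩ _
      exact (hinc x).1
    · rintro _ ⟨x, hx, rfl⟩ _
      exact (hinc x).2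
  · rw [Finset.card_insert_of_notMem, Finset.card_image_of_injective _ hinj]
    intro h
    obtain ⟨x, -, hx⟩ := Finset.mem_image.1 h
    exact (hinc x).1 hx.le

/-- If all subposets of `P` of width at most two lie in the family, the same holds for the tower.
If the part of the subposet in the blocks is a chain, the subposet is ladder-like. Otherwise block
`i` contains two incomparable elements of the subposet; every rung that occurs is comparable to one
of them, so it is above block `i`, and the blocks of index at least `i` are below everything
else. -/
theorem ladderSeriesFamily_of_embedding
    (hP : ∀ (Q : Type v) [PartialOrder Q] [Finite Q], WidthLE Q 2 → (Q ↪o P) →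
      LadderSeriesFamily Q) (n : ℕ) :
    ∀ (Q : Type v) [PartialOrder Q] [Finite Q], Nat.card Q = n → WidthLE Q 2 →
      (Q ↪o Tower g a) → LadderSeriesFamily Q := by
  classical
  induction n using Nat.strong_induction_on with
  | _ n ih =>
  intro Q _ _ hn hw f
  have hsplit : ∀ p : Q → Prop, (∀ x y, p x → ¬ p y → x < y) → (∃ x, p x) → (∃ x, ¬ p x) →
      LadderSeriesFamily Q := by
    rintro p hp ⟨x, hx⟩ ⟨y, hy⟩
    refine .of_split p hp ?_ ?_
    · exact ih _ (hn ▸ Finite.card_subtype_lt hy) _ rfl (hw.subtype p)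
        ((OrderEmbedding.subtype p).trans f)
    · exact ih _ (hn ▸ Finite.card_subtype_lt (not_not.2 hx)) _ rfl (hw.subtype _)
        ((OrderEmbedding.subtype _).trans f)
  have hlt : ∀ x y, f x ≤ f y → ¬ f y ≤ f x → x < y := fun x y h1 h2 =>
    f.lt_iff_lt.1 (lt_of_le_not_ge h1 h2)
  by_cases hch : ∀ q r, (∃ i x h, f q = block i x h) → (∃ i x h, f r = block i x h) →
      q ≤ r ∨ r ≤ q
  · refine .ladderLike Q ⟨{q | ∃ i x h, f q = block i x h}, {q | ∃ j, f q = rung g j},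
      fun q hq r hr _ => hch q r hq hr, ?_, ?_, ?_, ?_⟩
    · rintro q ⟨j, hj⟩ r ⟨k, hk⟩ -
      change q ≤ r ∨ r ≤ q
      rw [← f.le_iff_le, ← f.le_iff_le, hj, hk]
      exact le_total k j
    · rw [Set.disjoint_left]
      rintro q ⟨i, x, h, hq⟩ ⟨j, hj⟩
      rw [hq] at hj
      exact (incomp_block_rung (hx := h) (j := Fin.last a)).2 (Fin.le_last i) |>.2
        (hj ▸ rung_le_rung.2 (Fin.le_last j))
    · ext q
      simpa using (f q).cases
    · rintro q ⟨i, x, h, hq⟩ r ⟨j, hj⟩ hqr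
      have hnot : ¬ f r ≤ f q := by rw [hq, hj]; exact not_rung_le_block
      refine hlt q r ?_ hnot
      exact f.le_iff_le.2 (hqr.resolve_right fun h => hnot (f.le_iff_le.2 h))
  push Not at hch
  obtain ⟨q, r, ⟨i, x, hx, hq⟩, ⟨i', y, hy, hr⟩, hqr, hrq⟩ := hch
  have hii : i = i' := by
    rw [← f.le_iff_le, hq, hr, block_le_block, not_or] at hqr
    rw [← f.le_iff_le, hq, hr, block_le_block, not_or] at hrq
    exact le_antisymm (not_lt.1 hqr.1) (not_lt.1 hrq.1)
  subst hii
  have hrung : ∀ s j, f s = rung g j → j < i := by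
    intro s j hs
    by_contra hij
    have h1 : Incomp q s := by
      have : Incomp (f q) (f s) := by rw [hq, hs]; exact incomp_block_rung.2 (not_lt.1 hij)
      exact ⟨fun h => this.1 (f.le_iff_le.2 h), fun h => this.2 (f.le_iff_le.2 h)⟩
    have h2 : Incomp r s := by
      have : Incomp (f r) (f s) := by rw [hr, hs]; exact incomp_block_rung.2 (not_lt.1 hij)
      exact ⟨fun h => this.1 (f.le_iff_le.2 h), fun h => this.2 (f.le_iff_le.2 h)⟩
    have hqr' : q ≠ r := fun h => hqr h.le
    have := hw {q, r, s} (by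
      rw [Finset.coe_insert, Finset.coe_pair]
      refine IsAntichain.insert (Set.pairwise_pair.2 fun _ => h2) ?_ ?_
      · rintro b (rfl | rfl) -
        exacts [hrq, h1.2]
      · rintro b (rfl | rfl) -
        exacts [hqr, h1.1])
    rw [Finset.card_eq_three.2 ⟨q, r, s, hqr', h1.ne, h2.ne, rfl⟩] at this
    omega
  by_cases hall : ∃ z, ¬ ∃ k x h, f z = block k x h ∧ i ≤ k
  · refine hsplit (fun z => ∃ k x h, f z = block k x h ∧ i ≤ k) ?_ ⟨q, i, x, hx, hq, le_rfl⟩ hall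
    rintro z z' ⟨k, x, h, hz, hik⟩ hz'
    rcases (f z').cases with ⟨k', x', h', hz''⟩ | ⟨j, hj⟩
    · have hk' : k' < i := by
        by_contra hcon
        exact hz' ⟨k', x', h', hz'', not_lt.1 hcon⟩
      refine hlt z z' ?_ ?_ <;> rw [hz, hz'', block_le_block]
      · exact Or.inl (hk'.trans_le hik)
      · rintro (h | h)
        · exact lt_asymm h (hk'.trans_le hik)
        · exact (hk'.trans_le hik).ne h.1
    · refine hlt z z' ?_ ?_ <;> rw [hz, hj]
      · exact block_le_rung.2 ((hrung z' j hj).trans_le hik)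
      · exact not_rung_le_block
  push Not at hall
  by_cases hup : ∃ z, ∃ k x h, f z = block k x h ∧ i < k
  · refine hsplit (fun z => ∃ k x h, f z = block k x h ∧ i < k) ?_ hup ⟨q, ?_⟩
    · rintro z z' ⟨k, x, h, hz, hik⟩ hz'
      obtain ⟨k', x', h', hz'', hik'⟩ := hall z'
      have hk' : k' = i := by
        by_contra hcon
        exact hz' ⟨k', x', h', hz'', lt_of_le_of_ne hik' (Ne.symm hcon)⟩
      subst hk'
      refine hlt z z' ?_ ?_ <;> rw [hz, hz'', block_le_block]
      · exact Or.inl hik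
      · rintro (h | h)
        · exact lt_asymm h hik
        · exact hik.ne h.1
    · rintro ⟨k, x', h', hq', hik⟩
      have h3 : block i x hx ≤ block k x' h' := by rw [← hq, ← hq']
      rcases block_le_block.1 h3 with h | h
      · exact lt_asymm h hik
      · exact hik.ne h.1
  have hblock : ∀ z, ∃ x, ∃ h : i = 0 ∨ g x < i, f z = block i x h := by
    intro z
    obtain ⟨k, x, h, hz, hik⟩ := hall z
    have hk : k = i := by
      by_contra hcon
      exact hup ⟨z, k, x, h, hz, lt_of_le_of_ne hik (Ne.symm hcon)⟩
    subst hk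
    exact ⟨x, h, hz⟩
  choose e he hfe using hblock
  refine hP Q hw (OrderEmbedding.ofMapLEIff e fun z z' => ?_)
  rw [← f.le_iff_le, hfe, hfe, block_le_block]
  simp

end Tower

/-- For each `w` there is a poset of width `w` with a Grundy colouring by `2 ^ w - 1` colours all of
whose subposets of width at most two lie in the family. -/
theorem exists_grundy_two_pow_sub_one (w : ℕ) :
    ∃ (P : Type) (_ : PartialOrder P) (_ : Finite P) (g : P → ℕ), IsGrundy g ∧
      Set.range g = Set.Iio (2 ^ w - 1) ∧ WidthLE P w ∧
      (∃ A : Finset P, IsAntichain (· ≤ ·) (A : Set P) ∧ A.card = w) ∧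
      ∀ (Q : Type v) [PartialOrder Q] [Finite Q], WidthLE Q 2 → (Q ↪o P) →
        LadderSeriesFamily Q := by
  induction w with
  | zero =>
    refine ⟨Empty, inferInstance, inferInstance, fun _ => 0, ⟨fun x => x.elim, fun x => x.elim⟩,
      ?_, fun A _ => ?_, ⟨∅, by simp, rfl⟩, fun Q _ _ _ f => ?_⟩
    · rw [Set.range_eq_empty]; ext x; simp
    · simp [Finset.eq_empty_of_isEmpty]
    · have : IsEmpty Q := ⟨fun q => (f q).elim⟩
      exact .ladderLike Q ⟨∅, ∅, by simp, by simp, by simp,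
        by simp [Set.eq_empty_of_isEmpty], by simp⟩
  | succ w ih =>
    obtain ⟨P, _, _, g, hg, hr, hw, ⟨A, hA, hAc⟩, hQ⟩ := ih
    refine ⟨Tower g (2 ^ w - 1), inferInstance, inferInstance, Tower.colour g (2 ^ w - 1),
      Tower.isGrundy_colour hg hr, ?_, Tower.widthLE hw, ?_, fun Q _ _ hQw f =>
        Tower.ladderSeriesFamily_of_embedding hQ _ Q rfl hQw f⟩
    · rw [Tower.range_colour hg hr]
      have := Nat.one_le_two_pow (n := w)
      congr 1
      rw [pow_succ]; omega
    · obtain ⟨B, hB, hBc⟩ := Tower.exists_antichain (g := g) (a := 2 ^ w - 1) hA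
      exact ⟨B, hB, by rw [hBc, hAc]⟩

theorem posetWidth_eq {P : Type u} [PartialOrder P] [Finite P] {w : ℕ} (hw : WidthLE P w)
    {A : Finset P} (hA : IsAntichain (· ≤ ·) (A : Set P)) (hAc : A.card = w) :
    posetWidth P = (w : ℕ∞) := by
  apply le_antisymm
  · refine iSup₂_le fun B hB => ?_
    have hfin := Set.toFinite B
    rw [hfin.encard_eq_coe_toFinset_card]
    exact_mod_cast hw hfin.toFinset (by simpa using hB)
  · rw [← hAc, ← Set.encard_coe_eq_coe_finsetCard]
    exact le_iSup₂ (f := fun (A : Set P) (_ : IsAntichain (· ≤ ·) A) => A.encard) (A : Set P) hA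

theorem two_pow_sub_one_le_FF {Q : Type u} [PartialOrder Q] [Finite Q] (hQ : posetWidth Q = 2)
    (h : ¬ LadderSeriesFamily Q) (w : ℕ) : ((2 ^ w - 1 : ℕ) : ℕ∞) ≤ FF w Q := by
  obtain ⟨P, _, _, g, hg, hr, hw, ⟨A, hA, hAc⟩, hfam⟩ := exists_grundy_two_pow_sub_one.{u} w
  obtain ⟨l, hl, hlen⟩ := hg.exists_isPresentationOrder hr
  refine le_sSup ⟨P, inferInstance, inferInstance, l, posetWidth_eq hw hA hAc, ?_, hl,
    by rw [hlen]⟩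
  rintro ⟨f⟩
  exact h (hfam Q (widthLE_of_posetWidth_le (by exact_mod_cast hQ.le)) f)

theorem mainTheorem1 :
    (∃ c : ℝ, 0 < c ∧
      ∀ (Q : Type u) [PartialOrder Q] [Finite Q], posetWidth Q = 2 → LadderSeriesFamily Q →
        ∀ w : ℕ, 1 ≤ w →
          ∃ m : ℕ, FF w Q = (m : ℕ∞) ∧
            (m : ℝ) ≤ (2 : ℝ) ^ (c * (Nat.card Q : ℝ) * (Real.logb 2 (w : ℝ)) ^ 2)) ∧
    (∀ (Q : Type u) [PartialOrder Q] [Finite Q], posetWidth Q = 2 → ¬ LadderSeriesFamily Q →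
        ∀ w : ℕ, 1 ≤ w → ((2 ^ w - 1 : ℕ) : ℕ∞) ≤ FF w Q) :=
  ⟨⟨32, by norm_num, fun _ _ _ hQ h _ hw => FF_eq_and_le_of_ladderSeriesFamily hQ h hw⟩,
    fun _ _ _ hQ h w _ => two_pow_sub_one_le_FF hQ h w⟩
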